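/- \textbf{Setting.} Let $N\ge 1$, $K\ge 1$, $0\le M\le K$ be integers, let $\mathcal X$ be a finite alphabet with at least two symbols, and let $1\ge r_1\ge r_2\ge\dots\ge r_M\ge 0$ be real numbers; put $S=\sum_{i=1}^M r_i$. All entropies are taken to base $|\mathcal X|$. Each of $N$ non-colluding databases stores the same $K$ messages $W_1,\dots,W_K\in\mathcal X^L$, which are independent and uniformly distributed. The user has accessed $M$ distinct messages, described by an injection $\mathbb H:\{1,\dots,M\}\to\{1,\dots,K\}$, and has cached the first $\lfloor r_iL\rfloor$ symbols of $W_{\mathbb H(i)}$ for $i=1,\dots,M$ (a cache of size $SL$ up to rounding); call the cache contents $\mathcal W_{\mathbb H}$. A scheme of message length $L$ prescribes, for every $\theta\in\{1,\dots,K\}$ and every $\mathbb H$, a discrete joint law of queries $Q_1^{[\theta,\mathbb H]},\dots,Q_N^{[\theta,\mathbb H]}$, drawn independently of $(W_1,\dots,W_K)$, and for every $n$ an answering function, so that the answer $A_n^{[\theta,\mathbb H]}$ of database $n$ is a function of $Q_n^{[\theta,\mathbb H]}$ and $W_1,\dots,W_K$. The scheme is \emph{private} if for each $n$ the law of $(Q_n^{[\theta,\mathbb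 H]},A_n^{[\theta,\mathbb H]},W_1,\dots,W_K)$ does not depend on $(\theta,\mathbb H)$. Its download cost is $D=\sum_{n=1}^N H(A_n^{[\theta,\mathbb H]})$, which for a private scheme does not depend on $(\theta,\mathbb H)$. A number $d$ is an \emph{achievable normalized download cost} if there is a sequence of private schemes with message lengths $L\to\infty$ such that $D/L\to d$ and, for all $\theta$ and $\mathbb H$, $$H\bigl(W_\theta\,\big|\,\mathcal W_{\mathbb H},Q_1^{[\theta,\mathbb H]},\dots,Q_N^{[\theta,\mathbb H]},A_1^{[\theta,\mathbb H]},\dots,A_N^{[\theta,\mathbb H]}\bigr)=o(L).$$ The optimal normalized download cost $D^*$ is the infimum of all achievable normalized download costs. \textbf{Theorem.} $$D^*=1+\frac1N+\frac1{N^2}+\dots+\frac1{N^{K-1-M}}+\frac{1-r_M}{N^{K-M}}+\frac{1-r_{M-1}}{N^{K-M+1}}+\dots+\frac{1-r_1}{N^{K-1}},$$ that is, $D^*=\sum_{k=0}^{K-M-1}N^{-k}+\sum_{i=1}^{M}(1-r_i)\,N^{-(K-i)}$ (the first sum is empty if $M=K$). -/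

import Mathlib

open scoped ENNReal Topology

noncomputable section

namespace PIRPSI

/-- Shannon entropy `H(X)`, in units of `log b`, of the discrete random variable `X` on the
discrete probability space `(Ω, p)`.  Every summand is the `ofReal` of a nonnegative number. -/
def entropy {Ω α : Type*} (b : ℕ) (p : PMF Ω) (X : Ω → α) : ℝ≥0∞ :=
  ∑' x, ENNReal.ofReal (-((p.map X x).toReal * Real.logb b (p.map X x).toReal))

/-- Conditional Shannon entropy
`H(X | Y) = - ∑_{x, y} P(X = x, Y = y) log_b (P(X = x, Y = y) / P(Y = y))`. -/
def condEntropy {Ω α β : Type*} (b : ℕ) (p : PMF Ω) (X : Ω → α) (Y : Ω → β) : ℝ≥0∞ :=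
  ∑' z : α × β,
    ENNReal.ofReal (-((p.map (fun ω => (X ω, Y ω)) z).toReal *
      Real.logb b ((p.map (fun ω => (X ω, Y ω)) z).toReal / (p.map Y z.2).toReal)))

/-- The contents of a database: `K` messages of `L` symbols each, over the alphabet `𝒳`. -/
abbrev Messages (𝒳 : Type*) (K L : ℕ) : Type _ := Fin K → Fin L → 𝒳

/-- Which messages the user has accessed: `ℍ i` is the message of which the fraction `r i`
is cached. -/
abbrev CacheIndex (M K : ℕ) : Type := Fin M ↪ Fin K

/-- The cache contents `𝒲_ℍ`: the first `⌊r i * L⌋` symbols of message `ℍ i`, for every `i`. -/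
def cached {𝒳 : Type*} {K M L : ℕ} (r : Fin M → ℝ) (ℍ : CacheIndex M K) (w : Messages 𝒳 K L) :
    (i : Fin M) → {l : Fin L // (l : ℕ) < ⌊r i * L⌋₊} → 𝒳 :=
  fun i l => w (ℍ i) l.1

/-- A retrieval scheme with `N` databases, each storing the same `K` messages of length `L`, for
a user who has accessed `M` messages.  Given the desired index `θ` and the cache indices `ℍ`, the
user draws the `N` queries at random, without looking at the messages.  Database `n` answers with a
function of its own query and of all the messages. -/
structure Scheme (𝒳 : Type*) (N K M L : ℕ) where
  /-- the set of possible queries (a `PMF` on it is a discrete law; it need not be finite) -/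
  Query : Type
  /-- the set of possible answering strings -/
  Answer : Type
  /-- the joint law of the queries `Q₁, …, Q_N`, given `θ` and `ℍ` -/
  queryLaw : Fin K → CacheIndex M K → PMF (Fin N → Query)
  /-- the answering function of each database -/
  answer : Fin N → Query → Messages 𝒳 K L → Answer

namespace Scheme

variable {𝒳 : Type*} [Fintype 𝒳] [Nonempty 𝒳] {N K M L : ℕ} (𝒮 : Scheme 𝒳 N K M L)

/-- The joint law of all queries and all messages, given `θ` and `ℍ`: the messages consist of
`K * L` independent uniform symbols and are independent of the queries. -/
def jointLaw (θ : Fin K) (ℍ : CacheIndex M K) : PMF ((Fin N → 𝒮.Query) × Messages 𝒳 K L) :=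
  (𝒮.queryLaw θ ℍ).bind fun Q =>
    (PMF.uniformOfFintype (Messages 𝒳 K L)).map fun w => (Q, w)

/-- The answer `A_n` as a random variable. -/
def ans (n : Fin N) (ω : (Fin N → 𝒮.Query) × Messages 𝒳 K L) : 𝒮.Answer :=
  𝒮.answer n (ω.1 n) ω.2

/-- Privacy: what database `n` sees, that is `(Q_n, A_n, W_1, …, W_K)`, has the same law for all
desired indices and all cache indices. -/
def IsPrivate : Prop :=
  ∀ (n : Fin N) (θ θ' : Fin K) (ℍ ℍ' : CacheIndex M K),
    (𝒮.jointLaw θ ℍ).map (fun ω => (ω.1 n, 𝒮.ans n ω, ω.2)) =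
      (𝒮.jointLaw θ' ℍ').map (fun ω => (ω.1 n, 𝒮.ans n ω, ω.2))

/-- `H(W_θ | 𝒲_ℍ, Q_1, …, Q_N, A_1, …, A_N)`, given `θ` and `ℍ`, in symbols. -/
def equivocation (r : Fin M → ℝ) (θ : Fin K) (ℍ : CacheIndex M K) : ℝ≥0∞ :=
  condEntropy (Fintype.card 𝒳) (𝒮.jointLaw θ ℍ) (fun ω => ω.2 θ)
    (fun ω => (cached r ℍ ω.2, ω.1, fun n => 𝒮.ans n ω))

/-- The download cost `D = ∑ n, H(A_n)`, given `θ` and `ℍ`, in symbols. -/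
def download (θ : Fin K) (ℍ : CacheIndex M K) : ℝ≥0∞ :=
  ∑ n, entropy (Fintype.card 𝒳) (𝒮.jointLaw θ ℍ) (𝒮.ans n)

end Scheme

/-- `d` is an achievable normalized download cost for the caching scheme `r`: there are private
schemes, for message lengths `L → ∞`, with `H(W_θ | …) = o(L)` and `D / L → d`. -/
def IsAchievable (𝒳 : Type*) [Fintype 𝒳] [Nonempty 𝒳] (N K M : ℕ) (r : Fin M → ℝ)
    (d : ℝ≥0∞) : Prop :=
  ∃ (L : ℕ → ℕ) (𝒮 : (j : ℕ) → Scheme 𝒳 N K M (L j)),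
    Filter.Tendsto L Filter.atTop Filter.atTop ∧
    (∀ j, (𝒮 j).IsPrivate) ∧
    (∀ θ ℍ, Filter.Tendsto (fun j => (𝒮 j).equivocation r θ ℍ / (L j : ℝ≥0∞))
      Filter.atTop (𝓝 0)) ∧
    (∀ θ ℍ, Filter.Tendsto (fun j => (𝒮 j).download θ ℍ / (L j : ℝ≥0∞))
      Filter.atTop (𝓝 d))

/-- The optimal normalized download cost `D*` (`∞` if nothing were achievable). -/
def optimalCost (𝒳 : Type*) [Fintype 𝒳] [Nonempty 𝒳] (N K M : ℕ) (r : Fin M → ℝ) : ℝ≥0∞ :=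
  sInf {d | IsAchievable 𝒳 N K M r d}

end PIRPSI

end

namespace PIRPSI

/-! ### Entropy on discrete probability spaces -/

section Entropy

variable {Ω α β ι : Type*}

/-! Converse. For a set `P` of symbol positions let `condDownload` be `∑ n, H(A_n | Q_n, W_P)`. It
involves each database separately, so privacy makes it independent of `θ` and `ℍ`. If `P` contains
the cache, the answers together with `W_P` reveal `W_θ` up to the equivocation. Hence they carry the
unknown symbols of `W_θ`, and also whatever they still carry once `W_θ` is known, which is at least
the average over `n` of what a single answer carries. This is `card_add_condDownload_le`: (unknown
symbols of `W_θ`) + `condDownload (P ∪ W_θ) / N` ≤ `condDownload P` + equivocation. Privacy allows a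
new `θ` at every step. Iterating over all messages, those never accessed first and then the accessed
ones from the least to the most cached, gives weight `N ^ (-s)` to the message in position `s`,
which is the formula.

Achievability. Cut each message into blocks, so that every block is cached entirely or treated as
unknown. Because `r` is decreasing, the ranks for which block `t` is cached are an initial segment,
and their number `m` depends on `t` but not on `ℍ`. Use a capacity-achieving code without side
information, `permutedSums`, in which a user knowing any `m` messages can predict `N ^ m` of the `N
^ K` symbols of each answer. The databases do not know which symbols are predictable, but they know
how many, so a Reed–Solomon syndrome of length `N ^ K - N ^ m` suffices (`eq_of_syndrome_eq`). The
cost of the block per message symbol is then `∑ k < K - m, N ^ (-k)`. Summed over the blocks, rank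
`i` contributes its term `N ^ (-(K - 1 - i))` only in the fraction `1 - r i` of blocks where it is
missing. -/

lemma tsum_map_mul (p : PMF Ω) (f : Ω → α) (g : α → ℝ≥0∞) :
    ∑' a, p.map f a * g a = ∑' ω, p ω * g (f ω) := by
  classical
  simp_rw [PMF.map_apply, ← ENNReal.tsum_mul_right]
  rw [ENNReal.tsum_comm]
  refine tsum_congr fun ω => ?_
  rw [tsum_eq_single (f ω)]
  · simp
  · intro a ha
    simp [ha]

lemma ofReal_neg_toReal_mul {x : ℝ≥0∞} (hx : x ≠ ∞) (y : ℝ) :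
    ENNReal.ofReal (-(x.toReal * y)) = x * ENNReal.ofReal (-y) := by
  rw [← mul_neg, ENNReal.ofReal_mul ENNReal.toReal_nonneg, ENNReal.ofReal_toReal hx]

/-- Entropy is the expected surprise. -/
lemma entropy_eq_tsum (b : ℕ) (p : PMF Ω) (X : Ω → α) :
    entropy b p X =
      ∑' ω, p ω * ENNReal.ofReal (-Real.logb b (p.map X (X ω)).toReal) := by
  rw [entropy, ← tsum_map_mul p X fun a => ENNReal.ofReal (-Real.logb b (p.map X a).toReal)]
  exact tsum_congr fun a => ofReal_neg_toReal_mul (PMF.apply_ne_top _ _) _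

/-- Conditional entropy is the expected conditional surprise. -/
lemma condEntropy_eq_tsum (b : ℕ) (p : PMF Ω) (X : Ω → α) (Y : Ω → β) :
    condEntropy b p X Y =
      ∑' ω, p ω * ENNReal.ofReal (-Real.logb b
        ((p.map (fun ω => (X ω, Y ω)) (X ω, Y ω)).toReal / (p.map Y (Y ω)).toReal)) := by
  rw [condEntropy, ← tsum_map_mul p (fun ω => (X ω, Y ω)) fun z => ENNReal.ofReal
    (-Real.logb b ((p.map (fun ω => (X ω, Y ω)) z).toReal / (p.map Y z.2).toReal))]
  exact tsum_congr fun a => ofReal_neg_toReal_mul (PMF.apply_ne_top _ _) _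

/-- The graph of `x ↦ -x log x` lies below its tangent at `x`. -/
lemma neg_mul_logb_add_le {b : ℕ} (hb : 2 ≤ b) {x y : ℝ} (hx : 0 < x) (hy : 0 ≤ y) :
    -(y * Real.logb b y) + (Real.log b)⁻¹ * y ≤
      y * -Real.logb b x + (Real.log b)⁻¹ * x := by
  have hlog : 0 < Real.log b := Real.log_pos (by exact_mod_cast hb)
  have key : y * (Real.log x - Real.log y) ≤ x - y := by
    rcases hy.eq_or_lt with rfl | hy
    · simpa using hx.le
    · have := Real.log_le_sub_one_of_pos (div_pos hx hy)
      rw [Real.log_div hx.ne' hy.ne'] at this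
      calc y * (Real.log x - Real.log y) ≤ y * (x / y - 1) := by gcongr
        _ = x - y := by field_simp
  have := mul_le_mul_of_nonneg_left key (inv_pos.2 hlog).le
  simp only [Real.logb, div_eq_mul_inv]
  linarith

/-- The tangent inequality without subtraction, so that it can be summed in `ℝ≥0∞`; probabilities
keep all the terms nonnegative. -/
lemma ofReal_neg_mul_logb_add_le {b : ℕ} (hb : 2 ≤ b) {x y : ℝ≥0∞} (hx : x ≠ 0) (hx1 : x ≤ 1)
    (hy : y ≤ 1) :
    ENNReal.ofReal (-(y.toReal * Real.logb b y.toReal)) + ENNReal.ofReal (Real.log b)⁻¹ * y ≤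
      y * ENNReal.ofReal (-Real.logb b x.toReal) + ENNReal.ofReal (Real.log b)⁻¹ * x := by
  have hlog : 0 < Real.log b := Real.log_pos (by exact_mod_cast hb)
  have hb1 : (1 : ℝ) < b := by exact_mod_cast hb
  have hxt : x ≠ ∞ := ne_top_of_le_ne_top ENNReal.one_ne_top hx1
  have hyt : y ≠ ∞ := ne_top_of_le_ne_top ENNReal.one_ne_top hy
  lift x to NNReal using hxt
  lift y to NNReal using hyt
  have hx0 : 0 < (x : ℝ) := by
    have : x ≠ 0 := by simpa using hx
    exact_mod_cast this.bot_lt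
  have hx1' : (x : ℝ) ≤ 1 := by exact_mod_cast hx1
  have hy1' : (y : ℝ) ≤ 1 := by exact_mod_cast hy
  have h1 : Real.logb b x ≤ 0 := Real.logb_nonpos hb1 hx0.le hx1'
  have h2 : Real.logb b y ≤ 0 := Real.logb_nonpos hb1 y.2 hy1'
  have key := neg_mul_logb_add_le hb hx0 y.2
  simp only [ENNReal.coe_toReal]
  rw [← ENNReal.ofReal_coe_nnreal (p := x), ← ENNReal.ofReal_coe_nnreal (p := y),
    ← ENNReal.ofReal_mul (by positivity), ← ENNReal.ofReal_mul y.coe_nonneg,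
    ← ENNReal.ofReal_mul (by positivity), ← ENNReal.ofReal_add, ← ENNReal.ofReal_add]
  · exact ENNReal.ofReal_le_ofReal key
  · exact mul_nonneg y.2 (by linarith)
  · positivity
  · rw [← mul_neg]; exact mul_nonneg y.2 (by linarith)
  · exact mul_nonneg (by positivity) y.2

/-- Conditioning on the component of a mixture does not increase entropy. -/
lemma tsum_mul_entropy_le_entropy_bind {b : ℕ} (hb : 2 ≤ b) (p : PMF ι) (f : ι → PMF Ω)
    (X : Ω → α) :
    ∑' q, p q * entropy b (f q) X ≤ entropy b (p.bind f) X := by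
  set c := ENNReal.ofReal (Real.log b)⁻¹ with hc
  simp only [entropy, PMF.map_bind, ← ENNReal.tsum_mul_left]
  rw [ENNReal.tsum_comm]
  refine ENNReal.tsum_le_tsum fun a => ?_
  set x := (p.bind fun q => (f q).map X) a with hx
  have hxs : x = ∑' q, p q * (f q).map X a := by rw [hx, PMF.bind_apply]
  by_cases h0 : x = 0
  · rw [hxs, ENNReal.tsum_eq_zero] at h0
    refine le_of_eq_of_le ?_ zero_le
    rw [ENNReal.tsum_eq_zero]
    intro q
    rcases mul_eq_zero.1 (h0 q) with h | h <;> simp [h]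
  have hx1 : x ≤ 1 := PMF.coe_le_one _ _
  have hxt : x ≠ ∞ := ne_top_of_le_ne_top ENNReal.one_ne_top hx1
  have hfin : c * x ≠ ∞ := ENNReal.mul_ne_top ENNReal.ofReal_ne_top hxt
  -- The linear terms of the tangent inequality at the mean `x` average to `c * x` on both sides,
  -- and this is finite, hence cancellable.
  rw [← ENNReal.add_le_add_iff_right hfin, ofReal_neg_toReal_mul hxt]
  calc _ = ∑' q, p q * (ENNReal.ofReal (-(((f q).map X a).toReal *
          Real.logb b ((f q).map X a).toReal)) + c * (f q).map X a) := by
        simp only [mul_add, ENNReal.tsum_add]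
        congr 1
        rw [hxs, ← ENNReal.tsum_mul_left]
        exact tsum_congr fun q => by ring
    _ ≤ ∑' q, p q * ((f q).map X a * ENNReal.ofReal (-Real.logb b x.toReal) + c * x) :=
        ENNReal.tsum_le_tsum fun q =>
          mul_le_mul_right (ofReal_neg_mul_logb_add_le hb h0 hx1 (PMF.coe_le_one _ _)) _
    _ = _ := by
        simp only [mul_add, ENNReal.tsum_add, ← mul_assoc, ENNReal.tsum_mul_right, ← hxs,
          PMF.tsum_coe, one_mul]

/-- The tangent inequality is taken at the uniform weight; its linear terms sum to `c` on both
sides. -/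
lemma entropy_le_logb_card {b : ℕ} (hb : 2 ≤ b) [Fintype α] (p : PMF Ω) (X : Ω → α) :
    entropy b p X ≤ ENNReal.ofReal (Real.logb b (Fintype.card α)) := by
  obtain ⟨ω, -⟩ := p.support_nonempty
  have : Nonempty α := ⟨X ω⟩
  have hn : (Fintype.card α : ℝ≥0∞) ≠ 0 := by simp
  set c := ENNReal.ofReal (Real.log b)⁻¹ with hc
  have hsum : ∑ a, p.map X a = 1 := by rw [← tsum_fintype (L := .unconditional _), PMF.tsum_coe]
  rw [entropy, tsum_fintype, ← ENNReal.add_le_add_iff_right (a := c) ENNReal.ofReal_ne_top]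
  calc _ = ∑ a, (ENNReal.ofReal (-((p.map X a).toReal * Real.logb b (p.map X a).toReal)) +
          c * p.map X a) := by
        rw [Finset.sum_add_distrib, ← Finset.mul_sum, hsum, mul_one]
    _ ≤ ∑ a, (p.map X a * ENNReal.ofReal (-Real.logb b ((Fintype.card α : ℝ≥0∞)⁻¹).toReal) +
          c * (Fintype.card α : ℝ≥0∞)⁻¹) := by
        refine Finset.sum_le_sum fun a _ => ofReal_neg_mul_logb_add_le hb (by simp) ?_
          (PMF.coe_le_one _ _)
        rw [ENNReal.inv_le_one]
        exact_mod_cast Fintype.card_pos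
    _ = _ := by
        rw [Finset.sum_add_distrib, ← Finset.sum_mul, hsum, one_mul, ← Finset.mul_sum]
        simp [Real.logb_inv, ENNReal.mul_inv_cancel hn]

/-- The conditional entropy vanishes if, almost surely, `Y` determines `X`. -/
lemma condEntropy_eq_zero {b : ℕ} (p : PMF Ω) (X : Ω → α) (Y : Ω → β)
    (h : ∀ ω ∈ p.support, ∀ ω' ∈ p.support, Y ω = Y ω' → X ω = X ω') :
    condEntropy b p X Y = 0 := by
  classical
  rw [condEntropy_eq_tsum, ENNReal.tsum_eq_zero]
  intro ω
  by_cases hω : p ω = 0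
  · simp [hω]
  have : p.map (fun ω => (X ω, Y ω)) (X ω, Y ω) = p.map Y (Y ω) := by
    simp only [PMF.map_apply, Prod.mk.injEq]
    refine tsum_congr fun ω' => ?_
    by_cases hω' : p ω' = 0
    · simp [hω']
    · refine if_congr ⟨fun hh => hh.2, fun hY => ⟨?_, hY⟩⟩ rfl rfl
      exact h ω ((PMF.mem_support_iff _ _).2 hω) ω' ((PMF.mem_support_iff _ _).2 hω') hY
  rw [this]
  -- The quotient `x / x` is `1`, or `0` by convention, and `logb` vanishes at both.
  generalize (p.map Y (Y ω)).toReal = x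
  by_cases h0 : x = 0 <;> simp [h0]

end Entropy

end PIRPSI

namespace PIRPSI

/-! ### Entropy of functions on a finite uniform space, via fiber sizes -/

noncomputable section FiniteEntropy

open scoped Classical

variable {Ω α β γ δ : Type*} [Fintype Ω]

/-- The number of points at which `f` takes the value `f ω`. -/
def fiberCard (f : Ω → α) (ω : Ω) : ℕ := (Finset.univ.filter fun ω' => f ω' = f ω).card

/-- The entropy of `f` with respect to the uniform law on `Ω`. -/
def uniformEntropy (b : ℕ) (f : Ω → α) : ℝ :=
  (∑ ω, -Real.logb b (fiberCard f ω / Fintype.card Ω)) / Fintype.card Ω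

lemma fiberCard_pos (f : Ω → α) (ω : Ω) : 0 < fiberCard f ω :=
  Finset.card_pos.2 ⟨ω, by simp⟩

lemma fiberCard_congr {f : Ω → α} {g : Ω → β} {ω : Ω} (h : ∀ ω', f ω' = f ω ↔ g ω' = g ω) :
    fiberCard f ω = fiberCard g ω := by
  simp only [fiberCard, h]

lemma fiberCard_le {f : Ω → α} {g : Ω → β} (h : ∀ ω ω', f ω = f ω' → g ω = g ω') (ω : Ω) :
    fiberCard f ω ≤ fiberCard g ω := by
  refine Finset.card_le_card fun ω' => ?_
  simpa using h ω' ω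

lemma fiberCard_eq_of_eq {f : Ω → α} {ω ω' : Ω} (h : f ω = f ω') :
    fiberCard f ω = fiberCard f ω' := by
  simp only [fiberCard, h]

lemma uniformEntropy_mono {b : ℕ} (hb : 2 ≤ b) {f : Ω → α} {g : Ω → β}
    (h : ∀ ω ω', f ω = f ω' → g ω = g ω') : uniformEntropy b g ≤ uniformEntropy b f := by
  have hb1 : (1 : ℝ) < b := by exact_mod_cast hb
  unfold uniformEntropy
  gcongr with ω
  · have : Nonempty Ω := ⟨ω⟩
    have := fiberCard_pos f ω
    have : 0 < Fintype.card Ω := Fintype.card_pos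
    positivity
  · exact fiberCard_le h ω

lemma uniformEntropy_congr (b : ℕ) {f : Ω → α} {g : Ω → β}
    (h : ∀ ω ω', f ω = f ω' ↔ g ω = g ω') : uniformEntropy b f = uniformEntropy b g := by
  unfold uniformEntropy
  congr 1
  exact Finset.sum_congr rfl fun ω _ => by rw [fiberCard_congr fun ω' => h ω' ω]

lemma uniformEntropy_const (b : ℕ) (a : α) : uniformEntropy b (fun _ : Ω => a) = 0 := by
  rcases isEmpty_or_nonempty Ω with h | h
  · simp [uniformEntropy]
  · simp [uniformEntropy, fiberCard, Finset.card_univ]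

/-- Expand the numerator as a count of pairs `(ω₁, ω₂)` and sum over `ω` first. For a fixed pair,
the admissible `ω` are empty or exactly one fiber of `(f, g)`, which cancels the factor for `(f,
g)`; in the latter case `ω₁` and `ω₂` lie in the same fiber of `h`. -/
lemma sum_fiberCard_ratio_le {f : Ω → α} {g : Ω → β} {h : Ω → γ}
    (hf : ∀ ω ω', f ω = f ω' → h ω = h ω') (hg : ∀ ω ω', g ω = g ω' → h ω = h ω') :
    ∑ ω, (fiberCard f ω * fiberCard g ω : ℝ) /
      (fiberCard (fun ω => (f ω, g ω)) ω * fiberCard h ω) ≤ Fintype.card Ω := by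
  set k := fun ω => (f ω, g ω) with hk
  have hpos : ∀ ω, (0 : ℝ) < fiberCard h ω := fun ω => by exact_mod_cast fiberCard_pos h ω
  have hkpos : ∀ ω, (0 : ℝ) < fiberCard k ω := fun ω => by exact_mod_cast fiberCard_pos k ω
  have e1 : ∀ ω, (fiberCard f ω * fiberCard g ω : ℝ) / (fiberCard k ω * fiberCard h ω) =
      ∑ ω₁, ∑ ω₂, if f ω₁ = f ω ∧ g ω₂ = g ω then
        ((fiberCard k ω : ℝ) * fiberCard h ω)⁻¹ else 0 := by
    intro ω
    simp only [ite_and, fiberCard, Finset.card_filter, Nat.cast_sum, Nat.cast_ite, Nat.cast_one,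
      Nat.cast_zero, div_eq_mul_inv, Finset.sum_mul, ite_mul, one_mul, zero_mul]
    refine Finset.sum_congr rfl fun ω₁ _ => ?_
    split_ifs
    · rfl
    · simp
  have e2 : ∀ ω₁ ω₂, (∑ ω, if f ω₁ = f ω ∧ g ω₂ = g ω then
        ((fiberCard k ω : ℝ) * fiberCard h ω)⁻¹ else 0) ≤
      if h ω₂ = h ω₁ then (fiberCard h ω₁ : ℝ)⁻¹ else 0 := by
    intro ω₁ ω₂
    by_cases hex : ∃ ω, f ω₁ = f ω ∧ g ω₂ = g ω
    · obtain ⟨ω₀, h1, h2⟩ := hex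
      have hh : h ω₂ = h ω₁ := (hg _ _ h2).trans (hf _ _ h1).symm
      rw [if_pos hh, h1, h2]
      have : ∀ ω, (if f ω₀ = f ω ∧ g ω₀ = g ω then
          ((fiberCard k ω : ℝ) * fiberCard h ω)⁻¹ else 0) =
          if k ω = k ω₀ then ((fiberCard k ω₀ : ℝ) * fiberCard h ω₁)⁻¹ else 0 := by
        intro ω
        have hiff : (f ω₀ = f ω ∧ g ω₀ = g ω) ↔ k ω = k ω₀ := by
          simp [hk, eq_comm]
        by_cases hc : k ω = k ω₀
        · rw [if_pos hc, if_pos (hiff.2 hc), fiberCard_eq_of_eq hc,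
            fiberCard_eq_of_eq (f := h) ((hf _ _ h1).trans (hf _ _ (hiff.2 hc).1))]
        · rw [if_neg hc, if_neg (mt hiff.1 hc)]
      simp only [this]
      rw [← Finset.sum_filter, Finset.sum_const, nsmul_eq_mul]
      have hc : (Finset.univ.filter fun ω => k ω = k ω₀).card = fiberCard k ω₀ := by
        unfold fiberCard; congr
      rw [hc, mul_inv, ← mul_assoc, mul_inv_cancel₀ (hkpos ω₀).ne', one_mul]
    · push Not at hex
      rw [Finset.sum_eq_zero]
      · split_ifs
        · exact (inv_pos.2 (hpos _)).le
        · exact le_rfl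
      · intro ω _
        exact if_neg fun hh => hex ω hh.1 hh.2
  calc _ = ∑ ω₁, ∑ ω₂, ∑ ω, if f ω₁ = f ω ∧ g ω₂ = g ω then
        ((fiberCard k ω : ℝ) * fiberCard h ω)⁻¹ else 0 := by
        rw [Finset.sum_congr rfl fun ω _ => e1 ω, Finset.sum_comm]
        exact Finset.sum_congr rfl fun ω₁ _ => Finset.sum_comm
    _ ≤ ∑ ω₁, ∑ ω₂, if h ω₂ = h ω₁ then (fiberCard h ω₁ : ℝ)⁻¹ else 0 :=
        Finset.sum_le_sum fun ω₁ _ => Finset.sum_le_sum fun ω₂ _ => e2 ω₁ ω₂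
    _ = ∑ ω₁ : Ω, 1 := by
        refine Finset.sum_congr rfl fun ω₁ _ => ?_
        rw [← Finset.sum_filter, Finset.sum_const, nsmul_eq_mul]
        exact mul_inv_cancel₀ (hpos ω₁).ne'
    _ = _ := by simp

/-- Submodularity of entropy: `h` is a common coarsening of `f` and `g`, and `k` is determined by
the pair `(f, g)`. -/
lemma uniformEntropy_submodular {b : ℕ} (hb : 2 ≤ b) {f : Ω → α} {g : Ω → β} {h : Ω → γ}
    {k : Ω → δ} (hf : ∀ ω ω', f ω = f ω' → h ω = h ω') (hg : ∀ ω ω', g ω = g ω' → h ω = h ω')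
    (hk : ∀ ω ω', f ω = f ω' → g ω = g ω' → k ω = k ω') :
    uniformEntropy b k + uniformEntropy b h ≤ uniformEntropy b f + uniformEntropy b g := by
  refine (add_le_add_left (uniformEntropy_mono hb (f := fun ω => (f ω, g ω)) (g := k)
    fun ω ω' hh => hk ω ω' (Prod.ext_iff.1 hh).1 (Prod.ext_iff.1 hh).2) _).trans ?_
  have hlog : 0 < Real.log b := Real.log_pos (by exact_mod_cast hb)
  unfold uniformEntropy
  rw [← add_div, ← add_div, ← Finset.sum_add_distrib, ← Finset.sum_add_distrib]
  refine div_le_div_of_nonneg_right ?_ (by positivity)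
  rw [← sub_nonpos, ← Finset.sum_sub_distrib]
  -- Pointwise, the entropy defect is the logarithm of the ratio in `sum_fiberCard_ratio_le`, and
  -- `log t ≤ t - 1`.
  have key : ∀ ω ∈ (Finset.univ : Finset Ω),
      -Real.logb b (fiberCard (fun ω => (f ω, g ω)) ω / Fintype.card Ω) +
        -Real.logb b (fiberCard h ω / Fintype.card Ω) -
        (-Real.logb b (fiberCard f ω / Fintype.card Ω) +
          -Real.logb b (fiberCard g ω / Fintype.card Ω)) ≤
      (Real.log b)⁻¹ * ((fiberCard f ω * fiberCard g ω : ℝ) /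
      (fiberCard (fun ω => (f ω, g ω)) ω * fiberCard h ω) - 1) := by
    intro ω _
    have : Nonempty Ω := ⟨ω⟩
    have c0 : (Fintype.card Ω : ℝ) ≠ 0 := by simp
    have h1 : (fiberCard f ω : ℝ) ≠ 0 := by exact_mod_cast (fiberCard_pos f ω).ne'
    have h2 : (fiberCard g ω : ℝ) ≠ 0 := by exact_mod_cast (fiberCard_pos g ω).ne'
    have h3 : (fiberCard h ω : ℝ) ≠ 0 := by exact_mod_cast (fiberCard_pos h ω).ne'
    have h4 : (fiberCard (fun ω => (f ω, g ω)) ω : ℝ) ≠ 0 := by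
      exact_mod_cast (fiberCard_pos _ ω).ne'
    refine le_trans (le_of_eq ?_) (mul_le_mul_of_nonneg_left (Real.log_le_sub_one_of_pos ?_)
      (inv_pos.2 hlog).le)
    · rw [Real.log_div (mul_ne_zero h1 h2) (mul_ne_zero h4 h3), Real.log_mul h1 h2,
        Real.log_mul h4 h3]
      simp only [Real.logb]
      rw [Real.log_div h1 c0, Real.log_div h2 c0, Real.log_div h3 c0, Real.log_div h4 c0]
      ring
    · positivity
  refine (Finset.sum_le_sum key).trans ?_
  rw [← Finset.mul_sum, Finset.sum_sub_distrib]
  have := sum_fiberCard_ratio_le hf hg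
  refine mul_nonpos_of_nonneg_of_nonpos (inv_pos.2 hlog).le ?_
  simpa using this

/-- Conditional entropies of several variables add up to at least that of the whole family. -/
lemma uniformEntropy_pi_le {b : ℕ} (hb : 2 ≤ b) {N : ℕ} (A : Fin N → Ω → α) (Y : Ω → β) :
    uniformEntropy b (fun ω => (fun n => A n ω, Y ω)) - uniformEntropy b Y ≤
      ∑ n, (uniformEntropy b (fun ω => (A n ω, Y ω)) - uniformEntropy b Y) := by
  have key : ∀ s : Finset (Fin N),
      uniformEntropy b (fun ω => (fun n : s => A n ω, Y ω)) - uniformEntropy b Y ≤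
      ∑ n ∈ s, (uniformEntropy b (fun ω => (A n ω, Y ω)) - uniformEntropy b Y) := by
    intro s
    induction s using Finset.induction_on with
    | empty =>
      rw [Finset.sum_empty, sub_nonpos]
      refine uniformEntropy_mono hb fun ω ω' hh => ?_
      simpa [funext_iff] using hh
    | insert n s hn ih =>
      rw [Finset.sum_insert hn]
      have := uniformEntropy_submodular hb (f := fun ω => (A n ω, Y ω))
        (g := fun ω => (fun n : s => A n ω, Y ω)) (h := Y)
        (k := fun ω => (fun n : (insert n s : Finset (Fin N)) => A n ω, Y ω))
        (fun ω ω' hh => (Prod.ext_iff.1 hh).2) (fun ω ω' hh => (Prod.ext_iff.1 hh).2)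
        (fun ω ω' h1 h2 => by
          simp only [Prod.mk.injEq, funext_iff, Subtype.forall, Finset.mem_insert] at h1 h2 ⊢
          refine ⟨?_, h1.2⟩
          rintro m (rfl | hm)
          · exact h1.1
          · exact h2.1 m hm)
      linarith
  refine le_trans (sub_le_sub_right (uniformEntropy_mono hb fun ω ω' hh => ?_) _)
    (key Finset.univ)
  simpa [funext_iff] using hh

lemma uniformOfFintype_map_apply [Nonempty Ω] (f : Ω → α) (ω : Ω) :
    (PMF.uniformOfFintype Ω).map f (f ω) = fiberCard f ω / Fintype.card Ω := by
  rw [PMF.map_apply, tsum_fintype, ← Finset.sum_filter]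
  simp only [PMF.uniformOfFintype_apply, Finset.sum_const, nsmul_eq_mul, fiberCard,
    div_eq_mul_inv, eq_comm]

lemma logb_fiberCard_nonpos {b : ℕ} (hb : 2 ≤ b) (f : Ω → α) (ω : Ω) :
    Real.logb b (fiberCard f ω / Fintype.card Ω) ≤ 0 := by
  refine Real.logb_nonpos (by exact_mod_cast hb) (by positivity) ?_
  refine div_le_one_of_le₀ ?_ (by positivity)
  exact_mod_cast Finset.card_le_univ _

lemma entropy_uniformOfFintype {b : ℕ} (hb : 2 ≤ b) [Nonempty Ω] (f : Ω → α) :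
    entropy b (PMF.uniformOfFintype Ω) f = ENNReal.ofReal (uniformEntropy b f) := by
  rw [entropy_eq_tsum, tsum_fintype, uniformEntropy, div_eq_inv_mul,
    ENNReal.ofReal_mul (by positivity), ENNReal.ofReal_sum_of_nonneg, Finset.mul_sum]
  · refine Finset.sum_congr rfl fun ω _ => ?_
    rw [uniformOfFintype_map_apply, PMF.uniformOfFintype_apply, ENNReal.toReal_div,
      ENNReal.ofReal_inv_of_pos (by exact_mod_cast Fintype.card_pos)]
    simp
  · intro ω _
    linarith [logb_fiberCard_nonpos hb f ω]

/-- The law of a pair of independent variables, the second of which is uniform. -/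
def withUniform {ι : Type*} (Ω : Type*) [Fintype Ω] [Nonempty Ω] (p : PMF ι) : PMF (ι × Ω) :=
  p.bind fun q => (PMF.uniformOfFintype Ω).map fun w => (q, w)

lemma tsum_withUniform_mul {ι : Type*} [Nonempty Ω] (p : PMF ι) (g : ι × Ω → ℝ≥0∞) :
    ∑' z, withUniform Ω p z * g z =
      ∑' q, p q * ∑ w, (Fintype.card Ω : ℝ≥0∞)⁻¹ * g (q, w) := by
  simp only [withUniform, PMF.bind_apply, ← ENNReal.tsum_mul_right]
  rw [ENNReal.tsum_comm]
  refine tsum_congr fun q => ?_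
  simp only [mul_assoc, ENNReal.tsum_mul_left]
  rw [tsum_map_mul, tsum_fintype]
  simp

lemma withUniform_map_apply {ι : Type*} [Nonempty Ω] (p : PMF ι) (Y : ι × Ω → β)
    (hY : ∀ z z', Y z = Y z' → z.1 = z'.1) (q : ι) (w : Ω) :
    (withUniform Ω p).map Y (Y (q, w)) =
      p q * (fiberCard (fun w => Y (q, w)) w / Fintype.card Ω) := by
  have e : (withUniform Ω p).map Y (Y (q, w)) =
      ∑' z, withUniform Ω p z * if Y (q, w) = Y z then 1 else 0 := by
    rw [PMF.map_apply]
    exact tsum_congr fun z => by split_ifs <;> simp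
  -- Since `Y` reveals the first component, only `q` contributes to this value of `Y`.
  rw [e, tsum_withUniform_mul, tsum_eq_single q]
  · rw [← Finset.mul_sum, Finset.sum_boole, ENNReal.div_eq_inv_mul]
    simp only [fiberCard, eq_comm]
  · intro q' hq'
    rw [Finset.sum_eq_zero, mul_zero]
    intro w' _
    rw [if_neg, mul_zero]
    exact fun h => hq' (hY _ _ h).symm

/-- If `Y` reveals the first component, conditional entropies can be computed componentwise. -/
lemma condEntropy_withUniform {ι : Type*} {b : ℕ} (hb : 2 ≤ b) [Nonempty Ω] (p : PMF ι)
    (X : ι × Ω → α) (Y : ι × Ω → β) (hY : ∀ z z', Y z = Y z' → z.1 = z'.1) :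
    condEntropy b (withUniform Ω p) X Y =
      ∑' q, p q * ENNReal.ofReal (uniformEntropy b (fun w => (X (q, w), Y (q, w))) -
        uniformEntropy b fun w => Y (q, w)) := by
  rw [condEntropy_eq_tsum, tsum_withUniform_mul]
  refine tsum_congr fun q => ?_
  by_cases hq : p q = 0
  · simp [hq]
  have hq' : (p q).toReal ≠ 0 := ENNReal.toReal_ne_zero.2 ⟨hq, PMF.apply_ne_top _ _⟩
  congr 1
  rw [uniformEntropy, uniformEntropy, ← sub_div, div_eq_inv_mul,
    ENNReal.ofReal_mul (by positivity), ← Finset.sum_sub_distrib, ENNReal.ofReal_sum_of_nonneg,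
    Finset.mul_sum]
  · refine Finset.sum_congr rfl fun w _ => ?_
    rw [withUniform_map_apply p Y hY q w,
      withUniform_map_apply p (fun z => (X z, Y z)) (fun z z' h => hY z z' (Prod.ext_iff.1 h).2)
        q w, ENNReal.ofReal_inv_of_pos (by exact_mod_cast Fintype.card_pos)]
    have c0 : (Fintype.card Ω : ℝ) ≠ 0 := by simp
    have h1 : (fiberCard (fun w => (X (q, w), Y (q, w))) w : ℝ) ≠ 0 := by
      exact_mod_cast (fiberCard_pos _ w).ne'
    have h2 : (fiberCard (fun w => Y (q, w)) w : ℝ) ≠ 0 := by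
      exact_mod_cast (fiberCard_pos _ w).ne'
    simp only [ENNReal.toReal_mul, ENNReal.toReal_div, ENNReal.toReal_natCast,
      ENNReal.ofReal_natCast]
    rw [mul_div_mul_left _ _ hq', Real.logb_div (div_ne_zero h1 c0) (div_ne_zero h2 c0)]
    congr 2
    ring
  · intro w _
    have : Real.logb b (fiberCard (fun w => (X (q, w), Y (q, w))) w / Fintype.card Ω) ≤
        Real.logb b (fiberCard (fun w => Y (q, w)) w / Fintype.card Ω) := by
      refine Real.logb_le_logb_of_le (by exact_mod_cast hb) ?_ ?_
      · have := fiberCard_pos (fun w => (X (q, w), Y (q, w))) w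
        have : 0 < Fintype.card Ω := Fintype.card_pos
        positivity
      · gcongr
        exact fiberCard_le (fun w w' h => (Prod.ext_iff.1 h).2) w
    linarith

end FiniteEntropy

end PIRPSI

namespace PIRPSI

/-! ### Converse: the recursion for one private scheme -/

noncomputable section Converse

open scoped Classical

variable {𝒳 : Type*} {N K M L : ℕ}

/-- The symbols of the messages at the positions in `P`. -/
def symbolsAt (P : Finset (Fin K × Fin L)) (w : Messages 𝒳 K L) : P → 𝒳 := fun p => w p.1.1 p.1.2

lemma symbolsAt_eq_iff {P : Finset (Fin K × Fin L)} {w w' : Messages 𝒳 K L} :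
    symbolsAt P w = symbolsAt P w' ↔ ∀ k l, (k, l) ∈ P → w k l = w' k l := by
  simp [symbolsAt, funext_iff]

lemma fiberCard_symbolsAt [Fintype 𝒳] (P : Finset (Fin K × Fin L)) (w : Messages 𝒳 K L) :
    fiberCard (symbolsAt P) w = Fintype.card 𝒳 ^ Pᶜ.card := by
  have h : fiberCard (symbolsAt P) w = (Fintype.piFinset fun k => Fintype.piFinset fun l =>
        if (k, l) ∈ P then {w k l} else Finset.univ).card := by
    unfold fiberCard
    congr 1
    ext w'
    simp only [Finset.mem_filter, Finset.mem_univ, true_and, symbolsAt_eq_iff,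
      Fintype.mem_piFinset]
    refine forall_congr' fun k => forall_congr' fun l => ?_
    by_cases hP : (k, l) ∈ P <;> simp [hP]
  rw [h, Fintype.card_piFinset]
  simp only [Fintype.card_piFinset]
  rw [← Fintype.prod_prod_type' (f := fun k l =>
    (if (k, l) ∈ P then ({w k l} : Finset 𝒳) else Finset.univ).card)]
  have : ∀ p : Fin K × Fin L, (if (p.1, p.2) ∈ P then ({w p.1 p.2} : Finset 𝒳)
      else Finset.univ).card = if p ∈ Pᶜ then Fintype.card 𝒳 else 1 := by
    intro p
    by_cases hP : p ∈ P <;> simp [hP, Finset.card_univ]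
  rw [Finset.prod_congr rfl fun p _ => this p, Finset.prod_ite_mem, Finset.univ_inter,
    Finset.prod_const]

/-- All fibers have the same size, so every outcome has the same surprise. -/
lemma uniformEntropy_symbolsAt [Fintype 𝒳] [Nontrivial 𝒳] (P : Finset (Fin K × Fin L)) :
    uniformEntropy (Fintype.card 𝒳) (symbolsAt P : Messages 𝒳 K L → _) = P.card := by
  have hq : 1 < Fintype.card 𝒳 := Fintype.one_lt_card
  have hq' : (1 : ℝ) < Fintype.card 𝒳 := by exact_mod_cast hq
  have hcard : Fintype.card (Messages 𝒳 K L) = Fintype.card 𝒳 ^ (P.card + Pᶜ.card) := by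
    rw [Finset.card_add_card_compl]
    simp [← pow_mul, mul_comm]
  have key : ∀ w : Messages 𝒳 K L, -Real.logb (Fintype.card 𝒳)
      (fiberCard (symbolsAt P) w / Fintype.card (Messages 𝒳 K L)) = P.card := by
    intro w
    have h0 : (Fintype.card 𝒳 : ℝ) ≠ 0 := by positivity
    rw [fiberCard_symbolsAt, hcard, ← Real.logb_inv, inv_div]
    push_cast
    rw [pow_add, mul_div_cancel_right₀ _ (pow_ne_zero _ h0), Real.logb_pow,
      Real.logb_self_eq_one hq', mul_one]
  rw [uniformEntropy, Finset.sum_congr rfl fun w _ => key w, Finset.sum_const, nsmul_eq_mul,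
    Finset.card_univ, mul_div_cancel_left₀]
  rw [Nat.cast_ne_zero]
  exact Fintype.card_ne_zero

/-- The positions of the cached symbols. -/
def cachedPositions (L : ℕ) (r : Fin M → ℝ) (ℍ : CacheIndex M K) : Finset (Fin K × Fin L) :=
  Finset.univ.filter fun p => ∃ i, ℍ i = p.1 ∧ (p.2 : ℕ) < ⌊r i * L⌋₊

lemma cached_eq_iff {r : Fin M → ℝ} {ℍ : CacheIndex M K} {w w' : Messages 𝒳 K L} :
    cached r ℍ w = cached r ℍ w' ↔
      symbolsAt (cachedPositions L r ℍ) w = symbolsAt (cachedPositions L r ℍ) w' := by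
  rw [symbolsAt_eq_iff]
  simp only [cachedPositions, Finset.mem_filter, Finset.mem_univ, true_and, cached, funext_iff,
    Subtype.forall]
  constructor
  · rintro h k l ⟨i, rfl, hl⟩
    exact h i l hl
  · intro h i l hl
    exact h _ _ ⟨i, rfl, hl⟩

/-- All positions of message `θ`. -/
def messagePositions (L : ℕ) (θ : Fin K) : Finset (Fin K × Fin L) :=
  Finset.univ.filter fun p => p.1 = θ

namespace Scheme

variable [Fintype 𝒳] [Nontrivial 𝒳] (𝒮 : Scheme 𝒳 N K M L)

/-- Projecting the privacy condition to `Q_n`: expectations depending on a single query are the same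
for all `θ` and `ℍ`. -/
lemma tsum_queryLaw_congr {𝒮 : Scheme 𝒳 N K M L} (h𝒮 : 𝒮.IsPrivate) (n : Fin N) (θ θ' : Fin K)
    (ℍ ℍ' : CacheIndex M K) (g : 𝒮.Query → ℝ≥0∞) :
    ∑' Q, 𝒮.queryLaw θ ℍ Q * g (Q n) = ∑' Q, 𝒮.queryLaw θ' ℍ' Q * g (Q n) := by
  have key : ∀ θ ℍ, ((𝒮.jointLaw θ ℍ).map fun ω => (ω.1 n, 𝒮.ans n ω, ω.2)).map Prod.fst =
      (𝒮.queryLaw θ ℍ).map fun Q => Q n := by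
    intro θ ℍ
    rw [PMF.map_comp, jointLaw, PMF.map_bind]
    simp only [PMF.map_comp, Function.comp_def]
    exact congrArg _ (funext fun Q => PMF.map_const _ _)
  rw [← tsum_map_mul (𝒮.queryLaw θ ℍ) (fun Q => Q n), ← key θ ℍ, h𝒮 n θ θ' ℍ ℍ', key,
    tsum_map_mul]

/-- `∑ n, H(A_n | Q_n, W_P)`, where `W_P` are the symbols at the positions `P`. -/
def condDownload (θ : Fin K) (ℍ : CacheIndex M K) (P : Finset (Fin K × Fin L)) : ℝ≥0∞ :=
  ∑ n, ∑' Q, 𝒮.queryLaw θ ℍ Q * ENNReal.ofReal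
    (uniformEntropy (Fintype.card 𝒳) (fun w => (𝒮.answer n (Q n) w, symbolsAt P w)) -
      uniformEntropy (Fintype.card 𝒳) (symbolsAt P : Messages 𝒳 K L → _))

lemma condDownload_congr {𝒮 : Scheme 𝒳 N K M L} (h𝒮 : 𝒮.IsPrivate) (θ θ' : Fin K)
    (ℍ ℍ' : CacheIndex M K) (P : Finset (Fin K × Fin L)) :
    𝒮.condDownload θ ℍ P = 𝒮.condDownload θ' ℍ' P :=
  Finset.sum_congr rfl fun n _ => tsum_queryLaw_congr h𝒮 n θ θ' ℍ ℍ' fun q => ENNReal.ofReal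
    (uniformEntropy (Fintype.card 𝒳) (fun w => (𝒮.answer n q w, symbolsAt P w)) -
      uniformEntropy (Fintype.card 𝒳) (symbolsAt P : Messages 𝒳 K L → _))

/-- Conditioning on the queries lowers `H(A_n)` by concavity; conditioning further on `W_P` lowers
it by submodularity over a constant. -/
lemma condDownload_le_download (θ : Fin K) (ℍ : CacheIndex M K) (P : Finset (Fin K × Fin L)) :
    𝒮.condDownload θ ℍ P ≤ 𝒮.download θ ℍ := by
  have hb : 2 ≤ Fintype.card 𝒳 := Fintype.one_lt_card
  refine Finset.sum_le_sum fun n _ => le_trans ?_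
    (tsum_mul_entropy_le_entropy_bind hb (𝒮.queryLaw θ ℍ) _ (𝒮.ans n))
  refine ENNReal.tsum_le_tsum fun Q => mul_le_mul_right ?_ _
  have e : entropy (Fintype.card 𝒳)
      ((PMF.uniformOfFintype (Messages 𝒳 K L)).map fun w => (Q, w)) (𝒮.ans n) =
      entropy (Fintype.card 𝒳) (PMF.uniformOfFintype (Messages 𝒳 K L)) (𝒮.answer n (Q n)) := by
    simp only [entropy, PMF.map_comp]
    rfl
  rw [e, entropy_uniformOfFintype hb]
  refine ENNReal.ofReal_le_ofReal ?_
  have := uniformEntropy_submodular hb (f := 𝒮.answer n (Q n))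
    (g := (symbolsAt P : Messages 𝒳 K L → _)) (h := fun _ => ())
    (k := fun w => (𝒮.answer n (Q n) w, symbolsAt P w)) (by simp) (by simp) (by simp_all)
  rw [uniformEntropy_const] at this
  linarith

/-- Retrieving message `θ` costs as many symbols as are still unknown, and what else is
downloaded is at least the `N`-th part of what a user who knows message `θ` would download. -/
lemma card_add_condDownload_le (r : Fin M → ℝ) (θ : Fin K) (ℍ : CacheIndex M K)
    {P : Finset (Fin K × Fin L)} (hP : cachedPositions L r ℍ ⊆ P) :
    ((messagePositions L θ \ P).card : ℝ≥0∞) +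
        (N : ℝ≥0∞)⁻¹ * 𝒮.condDownload θ ℍ (P ∪ messagePositions L θ) ≤
      𝒮.condDownload θ ℍ P + 𝒮.equivocation r θ ℍ := by
  set q := Fintype.card 𝒳 with hq
  have hb : 2 ≤ q := Fintype.one_lt_card
  set P' := P ∪ messagePositions L θ with hP'
  set A : (Fin N → 𝒮.Query) → Messages 𝒳 K L → Fin N → 𝒮.Answer :=
    fun Q w n => 𝒮.answer n (Q n) w with hA
  set Y : Messages 𝒳 K L → P → 𝒳 := symbolsAt P with hY
  set Y' : Messages 𝒳 K L → P' → 𝒳 := symbolsAt P' with hY'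
  set C : Messages 𝒳 K L → cachedPositions L r ℍ → 𝒳 := symbolsAt _ with hC
  have hYC : ∀ w w', Y w = Y w' → C w = C w' := by
    intro w w' h
    rw [hY, symbolsAt_eq_iff] at h
    rw [hC, symbolsAt_eq_iff]
    exact fun k l hkl => h k l (hP hkl)
  have hYY' : ∀ w w', Y' w = Y' w' ↔ w θ = w' θ ∧ Y w = Y w' := by
    intro w w'
    rw [hY, hY', symbolsAt_eq_iff, symbolsAt_eq_iff]
    simp only [hP', messagePositions, Finset.mem_union, Finset.mem_filter, Finset.mem_univ,
      true_and, funext_iff]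
    constructor
    · exact fun h => ⟨fun l => h _ _ (Or.inr rfl), fun k l hkl => h _ _ (Or.inl hkl)⟩
    · rintro ⟨h1, h2⟩ k l (h | rfl)
      · exact h2 k l h
      · exact h1 l
  have heq : 𝒮.equivocation r θ ℍ = ∑' Q, 𝒮.queryLaw θ ℍ Q * ENNReal.ofReal
      (uniformEntropy q (fun w => (w θ, C w, A Q w)) - uniformEntropy q fun w => (C w, A Q w)) := by
    refine (condEntropy_withUniform hb (𝒮.queryLaw θ ℍ) _ _ ?_).trans ?_
    · intro z z' h
      exact (Prod.ext_iff.1 (Prod.ext_iff.1 h).2).1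
    · refine tsum_congr fun Q => ?_
      congr 3
      · refine uniformEntropy_congr _ fun w w' => ?_
        simp [cached_eq_iff, hA, hC, ans]
      · refine uniformEntropy_congr _ fun w w' => ?_
        simp [cached_eq_iff, hA, hC, ans]
  have hU : ∑' Q, 𝒮.queryLaw θ ℍ Q * ENNReal.ofReal
      (uniformEntropy q (fun w => (A Q w, Y w)) - uniformEntropy q Y) ≤ 𝒮.condDownload θ ℍ P := by
    rw [condDownload, ← Summable.tsum_finsetSum fun _ _ => ENNReal.summable]
    refine ENNReal.tsum_le_tsum fun Q => ?_
    rw [← Finset.mul_sum, ← ENNReal.ofReal_sum_of_nonneg]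
    · refine mul_le_mul_right (ENNReal.ofReal_le_ofReal ?_) _
      exact uniformEntropy_pi_le hb (fun n w => 𝒮.answer n (Q n) w) Y
    · intro n _
      exact sub_nonneg.2 (uniformEntropy_mono hb fun w w' h => (Prod.ext_iff.1 h).2)
  -- The tuple of answers determines each of the `N` answers, hence carries at least their average
  -- information.
  have hU' : (N : ℝ≥0∞)⁻¹ * 𝒮.condDownload θ ℍ P' ≤ ∑' Q, 𝒮.queryLaw θ ℍ Q * ENNReal.ofReal
      (uniformEntropy q (fun w => (A Q w, Y' w)) - uniformEntropy q Y') := by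
    rw [mul_comm, ← div_eq_mul_inv]
    refine ENNReal.div_le_of_le_mul ?_
    rw [mul_comm]
    refine (Finset.sum_le_card_nsmul _ _ (∑' Q, 𝒮.queryLaw θ ℍ Q * ENNReal.ofReal
      (uniformEntropy q (fun w => (A Q w, Y' w)) - uniformEntropy q Y')) ?_).trans ?_
    · intro n _
      refine ENNReal.tsum_le_tsum fun Q => mul_le_mul_right (ENNReal.ofReal_le_ofReal ?_) _
      refine sub_le_sub_right (uniformEntropy_mono hb fun w w' h => ?_) _
      simp only [hA, Prod.mk.injEq, funext_iff] at h ⊢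
      exact ⟨h.1 n, h.2⟩
    · simp
  have hcard : uniformEntropy q Y' - uniformEntropy q Y = (messagePositions L θ \ P).card := by
    rw [hY, hY', hq, uniformEntropy_symbolsAt, uniformEntropy_symbolsAt, hP', Finset.union_comm,
      ← Finset.sdiff_union_self_eq_union, Finset.card_union_of_disjoint Finset.sdiff_disjoint]
    push_cast
    ring
  refine (add_le_add_right hU' _).trans (le_trans ?_ (add_le_add_left hU _))
  have hone : ((messagePositions L θ \ P).card : ℝ≥0∞) = ∑' Q, 𝒮.queryLaw θ ℍ Q *
      ENNReal.ofReal (messagePositions L θ \ P).card := by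
    rw [ENNReal.tsum_mul_right, PMF.tsum_coe, one_mul, ENNReal.ofReal_natCast]
  rw [heq, hone, ← ENNReal.tsum_add, ← ENNReal.tsum_add]
  refine ENNReal.tsum_le_tsum fun Q => ?_
  rw [← mul_add, ← mul_add, ← ENNReal.ofReal_add (by positivity), ← ENNReal.ofReal_add]
  · refine mul_le_mul_right (ENNReal.ofReal_le_ofReal ?_) _
    rw [← hcard]
    -- This says `H(W_θ | A, W_P) ≤ H(W_θ | A, C)`: the cache is part of `W_P`, and more knowledge
    -- can only help.
    have := uniformEntropy_submodular hb (f := fun w => (A Q w, Y w))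
      (g := fun w => (w θ, C w, A Q w)) (h := fun w => (C w, A Q w))
      (k := fun w => (A Q w, Y' w))
      (fun w w' h => by
        simp only [Prod.mk.injEq] at h ⊢
        exact ⟨hYC _ _ h.2, h.1⟩)
      (fun w w' h => (Prod.ext_iff.1 h).2)
      (fun w w' h1 h2 => by
        simp only [Prod.mk.injEq] at h1 h2 ⊢
        exact ⟨h1.1, (hYY' _ _).2 ⟨h2.1, h1.2⟩⟩)
    linarith
  · exact sub_nonneg.2 (uniformEntropy_mono hb fun w w' h => (Prod.ext_iff.1 h).2)
  · exact sub_nonneg.2 (uniformEntropy_mono hb fun w w' h => (Prod.ext_iff.1 h).2)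
  · exact sub_nonneg.2 (uniformEntropy_mono hb fun w w' h => (Prod.ext_iff.1 h).2)

/-- Retrieving the messages one after the other, in the order `σ`. -/
lemma sum_card_div_pow_le {𝒮 : Scheme 𝒳 N K M L} (h𝒮 : 𝒮.IsPrivate) (hN : 1 ≤ N)
    (r : Fin M → ℝ) (θ₀ : Fin K) (ℍ : CacheIndex M K) (σ : Equiv.Perm (Fin K)) :
    ∑ s : Fin K, ((N : ℝ≥0∞)⁻¹) ^ (s : ℕ) *
        ((messagePositions L (σ s) \ cachedPositions L r ℍ).card : ℝ≥0∞) ≤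
      𝒮.download θ₀ ℍ + ∑ θ, 𝒮.equivocation r θ ℍ := by
  have hN1 : (N : ℝ≥0∞)⁻¹ ≤ 1 := ENNReal.inv_le_one.2 (by exact_mod_cast hN)
  set P₀ := cachedPositions L r ℍ with hP₀
  set P : ℕ → Finset (Fin K × Fin L) := fun t =>
    P₀ ∪ Finset.univ.filter fun p => ((σ.symm p.1 : Fin K) : ℕ) < t with hP
  have key : ∀ t ≤ K, ∑ s ∈ Finset.univ.filter fun s : Fin K => (s : ℕ) < t, ((N : ℝ≥0∞)⁻¹) ^ (s : ℕ) *
        ((messagePositions L (σ s) \ P₀).card : ℝ≥0∞) +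
        ((N : ℝ≥0∞)⁻¹) ^ t * 𝒮.condDownload θ₀ ℍ (P t) ≤
      𝒮.download θ₀ ℍ + ∑ s ∈ Finset.univ.filter fun s : Fin K => (s : ℕ) < t, 𝒮.equivocation r (σ s) ℍ := by
    intro t
    induction t with
    | zero =>
      intro _
      simpa using 𝒮.condDownload_le_download θ₀ ℍ (P 0)
    | succ t ih =>
      intro ht
      have htK : t < K := ht
      set s₀ : Fin K := ⟨t, htK⟩ with hs₀
      have hfilter : (Finset.univ.filter fun s : Fin K => (s : ℕ) < t + 1) =
          insert s₀ (Finset.univ.filter fun s : Fin K => (s : ℕ) < t) := by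
        ext s
        simp only [Finset.mem_filter, Finset.mem_univ, true_and, Finset.mem_insert, Fin.ext_iff,
          hs₀]
        omega
      have hPs : P (t + 1) = P t ∪ messagePositions L (σ s₀) := by
        ext p
        simp only [hP, messagePositions, Finset.mem_union, Finset.mem_filter, Finset.mem_univ,
          true_and, or_assoc, ← Equiv.symm_apply_eq, Fin.ext_iff, hs₀]
        rw [Nat.lt_succ_iff_lt_or_eq]
      have hdiff : messagePositions L (σ s₀) \ P t = messagePositions L (σ s₀) \ P₀ := by
        ext p
        simp only [hP, messagePositions, Finset.mem_sdiff, Finset.mem_union, Finset.mem_filter,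
          Finset.mem_univ, true_and, not_or]
        refine and_congr_right fun h => ⟨fun h => h.1, fun h' => ⟨h', ?_⟩⟩
        rw [h]
        simp [hs₀]
      have step := 𝒮.card_add_condDownload_le r (σ s₀) ℍ (P := P t) Finset.subset_union_left
      -- Privacy enters here: the user retrieving `σ s₀` may be replaced by the one retrieving `θ₀`
      -- in both download terms.
      rw [← hPs, hdiff, condDownload_congr h𝒮 (σ s₀) θ₀ ℍ ℍ,
        condDownload_congr h𝒮 (σ s₀) θ₀ ℍ ℍ] at step
      have hns : s₀ ∉ Finset.univ.filter fun s : Fin K => (s : ℕ) < t := by simp [hs₀]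
      rw [hfilter, Finset.sum_insert hns, Finset.sum_insert hns]
      set a := ∑ s ∈ Finset.univ.filter fun s : Fin K => (s : ℕ) < t, ((N : ℝ≥0∞)⁻¹) ^ (s : ℕ) *
        ((messagePositions L (σ s) \ P₀).card : ℝ≥0∞)
      set e := ∑ s ∈ Finset.univ.filter fun s : Fin K => (s : ℕ) < t, 𝒮.equivocation r (σ s) ℍ
      calc _ = a + ((N : ℝ≥0∞)⁻¹) ^ t * ((messagePositions L (σ s₀) \ P₀).card +
            (N : ℝ≥0∞)⁻¹ * 𝒮.condDownload θ₀ ℍ (P (t + 1))) := by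
            simp only [hs₀]
            ring
        _ ≤ a + ((N : ℝ≥0∞)⁻¹) ^ t *
            (𝒮.condDownload θ₀ ℍ (P t) + 𝒮.equivocation r (σ s₀) ℍ) := by gcongr
        _ = (a + ((N : ℝ≥0∞)⁻¹) ^ t * 𝒮.condDownload θ₀ ℍ (P t)) +
            ((N : ℝ≥0∞)⁻¹) ^ t * 𝒮.equivocation r (σ s₀) ℍ := by ring
        _ ≤ (𝒮.download θ₀ ℍ + e) + 1 * 𝒮.equivocation r (σ s₀) ℍ :=
            add_le_add (ih htK.le) (mul_le_mul_left (pow_le_one' hN1 t) _)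
        _ = _ := by ring
  have hall : (Finset.univ.filter fun s : Fin K => (s : ℕ) < K) = Finset.univ := by
    ext s
    simp
  have := key K le_rfl
  rw [hall, Equiv.sum_comp σ fun θ => 𝒮.equivocation r θ ℍ] at this
  exact le_trans le_self_add this

end Scheme

end Converse

end PIRPSI

namespace PIRPSI

/-! ### Converse: the order of retrieval and the limit -/

noncomputable section LowerBound

open scoped Classical

variable {𝒳 : Type*} {N K M L : ℕ}

/-- Splits a geometric cost into a part common to all users and one term for each rank `i ≥ m` that
is not available. The converse takes `m = 0`, the block scheme takes for `m` the number of cached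
ranks. -/
lemma sum_range_sub_eq_add {K M m : ℕ} (hM : M ≤ K) (hm : m ≤ M) (g : ℕ → ℝ) :
    ∑ k ∈ Finset.range (K - m), g k = ∑ k ∈ Finset.range (K - M), g k +
      ∑ i : Fin M, if m ≤ (i : ℕ) then g (K - 1 - i) else 0 := by
  induction M, hm using Nat.le_induction with
  | base =>
    rw [Finset.sum_eq_zero (s := (Finset.univ : Finset (Fin m))), add_zero]
    intro i _
    exact if_neg (by omega)
  | succ M hm ih =>
    rw [ih (by omega), Fin.sum_univ_castSucc]
    obtain ⟨c, hc⟩ : ∃ c, K - M = c + 1 := ⟨K - M - 1, by omega⟩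
    have h1 : K - (M + 1) = c := by omega
    have h2 : K - 1 - M = c := by omega
    simp only [Fin.val_castSucc, Fin.val_last, hc, h1, h2, Finset.sum_range_succ, if_pos hm]
    ring

/-- The retrieval order of the converse: messages never accessed come first, and `ℍ 0`, of which
most is cached when `r` is decreasing, comes last and gets the smallest weight. -/
lemma exists_perm_extending (ℍ : CacheIndex M K) :
    ∃ σ : Equiv.Perm (Fin K), ∀ (i : Fin M) (h : K - 1 - (i : ℕ) < K),
      σ ⟨K - 1 - i, h⟩ = ℍ i := by
  have hM : M ≤ K := by simpa using Fintype.card_le_of_embedding ℍ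
  let ι : Fin M ↪ Fin K := ⟨fun i => ⟨K - 1 - i, by omega⟩, fun i j h => by
    simp only [Fin.mk.injEq] at h
    omega⟩
  let e : {x // x ∈ Set.range ι} ≃ {x // x ∈ Set.range ℍ} :=
    (Equiv.ofInjective ι ι.injective).symm.trans (Equiv.ofInjective ℍ ℍ.injective)
  refine ⟨e.extendSubtype, fun i h => ?_⟩
  rw [show (⟨K - 1 - i, h⟩ : Fin K) = ι i from rfl,
    Equiv.extendSubtype_apply_of_mem e _ ⟨i, rfl⟩]
  simp only [e, Equiv.trans_apply]
  rw [show (⟨ι i, ⟨i, rfl⟩⟩ : Set.range ι) = Equiv.ofInjective ι ι.injective i from rfl,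
    Equiv.symm_apply_apply]
  rfl

lemma card_messagePositions (L : ℕ) (θ : Fin K) : (messagePositions L θ).card = L := by
  have : messagePositions L θ = {θ} ×ˢ Finset.univ := by
    ext p
    simp only [messagePositions, Finset.mem_product, Finset.mem_filter, Finset.mem_univ, true_and,
      Finset.mem_singleton, and_true]
  rw [this, Finset.card_product]
  simp

lemma card_messagePositions_sdiff_of_notMem (r : Fin M → ℝ) (ℍ : CacheIndex M K) {θ : Fin K}
    (hθ : ∀ i, ℍ i ≠ θ) : (messagePositions L θ \ cachedPositions L r ℍ).card = L := by
  rw [Finset.sdiff_eq_self_of_disjoint, card_messagePositions]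
  rw [Finset.disjoint_left]
  intro p hp hp'
  simp only [messagePositions, cachedPositions, Finset.mem_filter, Finset.mem_univ,
    true_and] at hp hp'
  obtain ⟨i, hi, -⟩ := hp'
  exact hθ i (hi.trans hp)

lemma le_card_messagePositions_sdiff (r : Fin M → ℝ) (hr0 : ∀ i, 0 ≤ r i)
    (ℍ : CacheIndex M K) (i : Fin M) :
    (1 - r i) * L ≤ (messagePositions L (ℍ i) \ cachedPositions L r ℍ).card := by
  have hsub : messagePositions L (ℍ i) ∩ cachedPositions L r ℍ ⊆
      {ℍ i} ×ˢ (Finset.univ.filter fun l : Fin L => (l : ℕ) < ⌊r i * L⌋₊) := by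
    intro p hp
    simp only [messagePositions, cachedPositions, Finset.mem_inter, Finset.mem_filter,
      Finset.mem_univ, true_and] at hp
    obtain ⟨hp, j, hj, hjl⟩ := hp
    -- Injectivity of `ℍ` ensures that only rank `i` caches symbols of `ℍ i`.
    obtain rfl := ℍ.injective (hj.trans hp)
    simp only [Finset.mem_product, Finset.mem_singleton, Finset.mem_filter, Finset.mem_univ,
      true_and]
    exact ⟨hp, hjl⟩
  have h1 := Finset.card_le_card hsub
  rw [Finset.card_product, Finset.card_singleton, one_mul] at h1
  have h2 : (Finset.univ.filter fun l : Fin L => (l : ℕ) < ⌊r i * L⌋₊).card ≤ ⌊r i * L⌋₊ := by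
    rw [Fin.card_filter_val_lt]
    exact min_le_right _ _
  have h3 : (⌊r i * L⌋₊ : ℝ) ≤ r i * L := Nat.floor_le (mul_nonneg (hr0 i) (by positivity))
  have h4 := Finset.card_sdiff_add_card_inter (messagePositions L (ℍ i)) (cachedPositions L r ℍ)
  rw [card_messagePositions] at h4
  have h5 : (L : ℝ) ≤ (messagePositions L (ℍ i) \ cachedPositions L r ℍ).card + ⌊r i * L⌋₊ := by
    exact_mod_cast (by omega : L ≤ _ + _)
  linarith

/-- The optimal normalized download cost, in closed form. -/
def costFormula (N K M : ℕ) (r : Fin M → ℝ) : ℝ :=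
  (∑ k ∈ Finset.range (K - M), 1 / (N : ℝ) ^ k) +
    ∑ i : Fin M, (1 - r i) / (N : ℝ) ^ (K - 1 - (i : ℕ))

/-- The converse bound for a single scheme. -/
lemma Scheme.ofReal_costFormula_mul_le [Fintype 𝒳] [Nontrivial 𝒳] {𝒮 : Scheme 𝒳 N K M L}
    (h𝒮 : 𝒮.IsPrivate) (hN : 1 ≤ N) (r : Fin M → ℝ) (hr0 : ∀ i, 0 ≤ r i) (θ₀ : Fin K)
    (ℍ : CacheIndex M K) :
    ENNReal.ofReal (costFormula N K M r) * L ≤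
      𝒮.download θ₀ ℍ + ∑ θ, 𝒮.equivocation r θ ℍ := by
  have hM : M ≤ K := by simpa using Fintype.card_le_of_embedding ℍ
  obtain ⟨σ, hσ⟩ := exists_perm_extending ℍ
  refine le_trans ?_ (sum_card_div_pow_le h𝒮 hN r θ₀ ℍ σ)
  set c : Fin K → ℕ := fun s => (messagePositions L (σ s) \ cachedPositions L r ℍ).card with hc
  have hN0 : (0 : ℝ) < N := by exact_mod_cast hN
  have e : ∑ s : Fin K, ((N : ℝ≥0∞)⁻¹) ^ (s : ℕ) * (c s : ℝ≥0∞) =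
      ENNReal.ofReal (∑ s : Fin K, ((N : ℝ)⁻¹) ^ (s : ℕ) * c s) := by
    rw [ENNReal.ofReal_sum_of_nonneg fun s _ => by positivity]
    refine Finset.sum_congr rfl fun s _ => ?_
    rw [ENNReal.ofReal_mul (by positivity), ENNReal.ofReal_pow (by positivity),
      ENNReal.ofReal_inv_of_pos hN0, ENNReal.ofReal_natCast, ENNReal.ofReal_natCast]
  rw [e, ← ENNReal.ofReal_natCast, ← ENNReal.ofReal_mul' (by positivity)]
  refine ENNReal.ofReal_le_ofReal ?_
  set g : ℕ → ℝ := fun s => if h : s < K then ((N : ℝ)⁻¹) ^ s * c ⟨s, h⟩ else 0 with hg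
  have e2 : ∑ s : Fin K, ((N : ℝ)⁻¹) ^ (s : ℕ) * c s = ∑ s ∈ Finset.range (K - 0), g s := by
    rw [Nat.sub_zero, ← Fin.sum_univ_eq_sum_range]
    exact Finset.sum_congr rfl fun s _ => by simp [hg]
  rw [e2, sum_range_sub_eq_add hM (Nat.zero_le M), costFormula, add_mul, Finset.sum_mul,
    Finset.sum_mul]
  refine add_le_add (Finset.sum_le_sum fun s hs => ?_) (Finset.sum_le_sum fun i _ => ?_)
  · have hs' : s < K - M := Finset.mem_range.1 hs
    have hsK : s < K := by omega
    have : c ⟨s, hsK⟩ = L := by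
      refine card_messagePositions_sdiff_of_notMem r ℍ fun i hi => ?_
      rw [← hσ i (by omega), σ.apply_eq_iff_eq, Fin.mk.injEq] at hi
      omega
    simp only [hg, dif_pos hsK, this, one_div, inv_pow]
    exact le_rfl
  · have hsK : K - 1 - (i : ℕ) < K := by omega
    have := le_card_messagePositions_sdiff (L := L) r hr0 ℍ i
    simp only [hg, dif_pos hsK, Nat.zero_le, if_true, hc, hσ i hsK]
    calc _ = ((N : ℝ)⁻¹) ^ (K - 1 - (i : ℕ)) * ((1 - r i) * L) := by
          rw [inv_pow]; ring
      _ ≤ _ := by gcongr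

lemma ofReal_costFormula_le_of_isAchievable [Fintype 𝒳] [Nontrivial 𝒳] (hN : 1 ≤ N)
    (r : Fin M → ℝ) (hr0 : ∀ i, 0 ≤ r i) (θ₀ : Fin K) (ℍ : CacheIndex M K) {d : ℝ≥0∞}
    (hd : IsAchievable 𝒳 N K M r d) : ENNReal.ofReal (costFormula N K M r) ≤ d := by
  obtain ⟨L, 𝒮, hL, hpriv, heq, hdown⟩ := hd
  have hlim : Filter.Tendsto (fun j => (𝒮 j).download θ₀ ℍ / (L j : ℝ≥0∞) +
      ∑ θ, (𝒮 j).equivocation r θ ℍ / (L j : ℝ≥0∞)) Filter.atTop (𝓝 (d + ∑ _θ : Fin K, 0)) :=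
    (hdown θ₀ ℍ).add (tendsto_finsetSum _ fun θ _ => heq θ ℍ)
  rw [Finset.sum_const_zero, add_zero] at hlim
  refine ge_of_tendsto hlim ?_
  filter_upwards [hL.eventually_ge_atTop 1] with j hj
  have h := Scheme.ofReal_costFormula_mul_le (hpriv j) hN r hr0 θ₀ ℍ
  simp only [div_eq_mul_inv, ← Finset.sum_mul, ← add_mul]
  rw [← div_eq_mul_inv, ENNReal.le_div_iff_mul_le]
  · exact h
  · left
    exact_mod_cast (by omega : L j ≠ 0)
  · left
    simp

end LowerBound

end PIRPSI

namespace PIRPSI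

/-! ### Reed–Solomon syndromes and retrieval codes without side information -/

noncomputable section Codes

open scoped Classical

/-- The first `card J - s` power sums of `x` with nodes `α`: the syndrome of `x` for a
Reed–Solomon code. -/
def syndrome {F J : Type*} [Field F] [Fintype J] (α : J → F) (s : ℕ) (x : J → F) :
    Fin (Fintype.card J - s) → F :=
  fun i => ∑ j, x j * α j ^ (i : ℕ)

/-- The syndrome together with any `s` entries determines the vector. -/
lemma eq_of_syndrome_eq {F J : Type*} [Field F] [Fintype J] {α : J → F}
    (hα : Function.Injective α) {s : ℕ} {x y : J → F} (h : syndrome α s x = syndrome α s y)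
    {Z : Finset J} (hZ : s ≤ Z.card) (hxy : ∀ j ∈ Z, x j = y j) : x = y := by
  set e : Fin Zᶜ.card ≃ {j // j ∈ Zᶜ} := Zᶜ.equivFin.symm with he
  -- The difference is supported off `Z`, on at most `card J - s` distinct nodes, and that many
  -- power sums vanish: a Vandermonde system.
  have key : (fun i => x (e i) - y (e i)) = 0 := by
    refine Matrix.eq_zero_of_forall_pow_sum_mul_pow_eq_zero (f := fun i => α (e i))
      (hα.comp (Subtype.val_injective.comp e.injective)) fun i => ?_
    rw [Equiv.sum_comp e fun j : {j // j ∈ Zᶜ} => (x j - y j) * α j ^ (i : ℕ),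
      Finset.sum_coe_sort Zᶜ fun j => (x j - y j) * α j ^ (i : ℕ)]
    have hi : (i : ℕ) < Fintype.card J - s := by
      refine i.2.trans_le ?_
      rw [Finset.card_compl]
      omega
    have := congrFun h ⟨i, hi⟩
    simp only [syndrome] at this
    rw [← sub_eq_zero, ← Finset.sum_sub_distrib] at this
    rw [← this]
    refine (Finset.sum_subset (Finset.subset_univ _) fun j _ hj => ?_).trans
      (Finset.sum_congr rfl fun j _ => sub_mul _ _ _)
    rw [Finset.mem_compl, not_not] at hj
    rw [hxy j hj, sub_self, zero_mul]
  funext j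
  by_cases hj : j ∈ Z
  · exact hxy j hj
  · have := congrFun key (e.symm ⟨j, Finset.mem_compl.2 hj⟩)
    simpa [sub_eq_zero] using this

/-- A retrieval code for messages `C → F` over an arbitrary abelian group `F`, that does not make
use of side information.  Each database returns `J → F`; whoever knows `m` of the messages knows
`known m` entries of each answer in advance. -/
structure RetrievalCode (N K : ℕ) where
  /-- the queries -/
  Query : Type
  /-- the positions of an answer -/
  J : Type
  /-- the positions of a message -/
  C : Type
  [fintypeJ : Fintype J]
  [fintypeC : Fintype C]
  /-- the number of answer symbols known to whoever knows `m` messages -/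
  known : ℕ → ℕ
  /-- the joint law of the queries -/
  law : Fin K → PMF (Fin N → Query)
  /-- the answers -/
  answer : ∀ (F : Type) [AddCommGroup F], Fin N → Query → (Fin K → C → F) → J → F
  nonempty_C : Nonempty C
  law_map_eq : ∀ n θ θ', (law θ).map (fun Q => Q n) = (law θ').map fun Q => Q n
  decode : ∀ (F : Type) [AddCommGroup F] (θ : Fin K), ∀ Q ∈ (law θ).support, ∀ v v',
    (∀ n, answer F n (Q n) v = answer F n (Q n) v') → v θ = v' θ
  exists_known : ∀ (F : Type) [AddCommGroup F] (n : Fin N) (q : Query) (S : Finset (Fin K)),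
    ∃ Z : Finset J, known S.card ≤ Z.card ∧ ∀ v v' : Fin K → C → F,
      (∀ k ∈ S, v k = v' k) → ∀ j ∈ Z, answer F n q v j = answer F n q v' j
  known_le : ∀ m ≤ K, known m ≤ Fintype.card J
  cost : ∀ m ≤ K, (N : ℝ) * (Fintype.card J - known m) =
    Fintype.card C * ∑ k ∈ Finset.range (K - m), 1 / (N : ℝ) ^ k

attribute [instance] RetrievalCode.fintypeJ RetrievalCode.fintypeC

/-- A single database returns everything. -/
def downloadEverything (K : ℕ) : RetrievalCode 1 K where
  Query := Unit
  J := Fin K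
  C := Unit
  known := id
  law _ := PMF.pure fun _ => ()
  answer _ _ _ _ v k := v k ()
  nonempty_C := inferInstance
  law_map_eq _ _ _ := rfl
  decode _ _ θ _ _ v v' h := funext fun _ => congrFun (h 0) θ
  exists_known _ _ _ _ S := ⟨S, le_rfl, fun _ _ h k hk => congrFun (h k hk) ()⟩
  known_le m hm := by simpa using hm
  cost m hm := by simp [Nat.cast_sub hm]

lemma uniformOfFintype_map_equiv {α : Type*} [Fintype α] [Nonempty α] (e : α ≃ α) :
    (PMF.uniformOfFintype α).map e = PMF.uniformOfFintype α := by
  ext a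
  rw [PMF.map_apply, tsum_eq_single (e.symm a)]
  · simp
  · intro b hb
    rw [if_neg]
    rintro rfl
    simp at hb

/-- The symbol number `x` of run `j`, where number `0` stands for the neutral element. -/
def paddedSymbol {F J G : Type*} [Zero F] [Zero G] (u : J × {x : G // x ≠ 0} → F) (j : J) (x : G) :
    F :=
  if h : x ≠ 0 then u (j, ⟨x, h⟩) else 0

lemma card_filter_eq_zero_off {N K : ℕ} [NeZero N] (S : Finset (Fin K)) :
    (Finset.univ.filter fun x : Fin K → Fin N => ∀ k ∉ S, x k = 0).card =
      N ^ S.card := by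
  have h : (Finset.univ.filter fun x : Fin K → Fin N => ∀ k ∉ S, x k = 0) =
      Fintype.piFinset fun k => if k ∈ S then Finset.univ else {0} := by
    ext x
    simp only [Finset.mem_filter, Finset.mem_univ, true_and, Fintype.mem_piFinset]
    refine forall_congr' fun k => ?_
    by_cases hk : k ∈ S <;> simp [hk]
  rw [h, Fintype.card_piFinset]
  have : ∀ k, (if k ∈ S then (Finset.univ : Finset (Fin N)) else {0}).card =
      if k ∈ S then N else 1 := by
    intro k
    by_cases hk : k ∈ S <;> simp [hk]
  rw [Finset.prod_congr rfl fun k _ => this k, Finset.prod_ite_mem, Finset.univ_inter,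
    Finset.prod_const]

/-! ### The code of randomly permuted sums -/

section PermutedSums

variable {N K : ℕ} [NeZero N]

/-- The law of `n ↦ π + n • e_θ` for a uniformly random permutation `π` of `(Fin N) ^ K`. -/
def shiftedPermLaw (θ : Fin K) : PMF (Fin N → Equiv.Perm (Fin K → Fin N)) :=
  (PMF.uniformOfFintype (Equiv.Perm (Fin K → Fin N))).map fun π n =>
    Equiv.addRight (Pi.single θ n) * π

lemma shiftedPermLaw_map (θ : Fin K) (n : Fin N) :
    (shiftedPermLaw θ).map (fun Q => Q n) =
      PMF.uniformOfFintype (Equiv.Perm (Fin K → Fin N)) := by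
  unfold shiftedPermLaw
  have e : ((fun Q : Fin N → Equiv.Perm (Fin K → Fin N) => Q n) ∘ fun π n =>
      Equiv.addRight (Pi.single θ n) * π) = Equiv.mulLeft (Equiv.addRight (Pi.single θ n)) := by
    funext π
    simp
  rw [PMF.map_comp, e, uniformOfFintype_map_equiv]

lemma eq_of_forall_sum_paddedSymbol_eq {F : Type*} [AddCommGroup F] {θ : Fin K}
    {Q : Fin N → Equiv.Perm (Fin K → Fin N)} (hQ : Q ∈ (shiftedPermLaw θ).support)
    {v v' : Fin K → (Fin K → Fin N) × {x : Fin N // x ≠ 0} → F}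
    (h : ∀ n j, ∑ k, paddedSymbol (v k) j (Q n j k) = ∑ k, paddedSymbol (v' k) j (Q n j k)) :
    v θ = v' θ := by
  simp only [shiftedPermLaw, PMF.mem_support_map_iff, PMF.support_uniformOfFintype] at hQ
  obtain ⟨π, -, rfl⟩ := hQ
  have step : ∀ (j : Fin K → Fin N) (n : Fin N),
      ∑ k ∈ Finset.univ.erase θ, paddedSymbol (v k) j (π j k) +
        paddedSymbol (v θ) j (π j θ + n) =
      ∑ k ∈ Finset.univ.erase θ, paddedSymbol (v' k) j (π j k) +
        paddedSymbol (v' θ) j (π j θ + n) := by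
    intro j n
    have aux : ∀ u : Fin K → (Fin K → Fin N) × {x : Fin N // x ≠ 0} → F,
        ∑ k, paddedSymbol (u k) j
          ((Equiv.addRight (Pi.single θ n) * π : Equiv.Perm (Fin K → Fin N)) j k) =
        ∑ k ∈ Finset.univ.erase θ, paddedSymbol (u k) j (π j k) +
          paddedSymbol (u θ) j (π j θ + n) := by
      intro u
      rw [← Finset.sum_erase_add _ _ (Finset.mem_univ θ)]
      simp only [Equiv.Perm.mul_apply, Equiv.coe_addRight, Pi.add_apply, Pi.single_eq_same]
      congr 1
      refine Finset.sum_congr rfl fun k hk => ?_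
      rw [Pi.single_eq_of_ne (Finset.ne_of_mem_erase hk), add_zero]
    rw [← aux, ← aux]
    exact h n j
  funext ⟨j, x⟩
  -- The database `n = -π j θ` meets the padded symbol `0` of the desired message and so returns the
  -- bare interference; the database `x - π j θ` returns the same interference plus symbol `x`.
  have h0 := step j (-π j θ)
  have hx := step j (x - π j θ)
  simp only [add_neg_cancel, add_sub_cancel, paddedSymbol, ne_eq, not_true_eq_false, dite_false,
    add_zero, x.2, not_false_eq_true, dite_true] at h0 hx
  rw [h0] at hx
  exact add_left_cancel hx

/-- A sum is predictable from the messages in `S` if it uses the padding symbol `0` of every other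
message. As `π` is a permutation, exactly `N ^ S.card` runs are of this kind, wherever they sit. -/
lemma exists_known_sums (F : Type*) [AddCommGroup F] (π : Equiv.Perm (Fin K → Fin N))
    (S : Finset (Fin K)) :
    ∃ Z : Finset (Fin K → Fin N), N ^ S.card ≤ Z.card ∧
      ∀ v v' : Fin K → (Fin K → Fin N) × {x : Fin N // x ≠ 0} → F, (∀ k ∈ S, v k = v' k) →
        ∀ j ∈ Z, ∑ k, paddedSymbol (v k) j (π j k) = ∑ k, paddedSymbol (v' k) j (π j k) := by
  refine ⟨(Finset.univ.filter fun x : Fin K → Fin N => ∀ k ∉ S, x k = 0).map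
    π.symm.toEmbedding, ?_, ?_⟩
  · rw [Finset.card_map, card_filter_eq_zero_off]
  · intro v v' hv j hj
    rw [Finset.mem_map_equiv, Equiv.symm_symm, Finset.mem_filter] at hj
    refine Finset.sum_congr rfl fun k _ => ?_
    by_cases hk : k ∈ S
    · rw [hv k hk]
    · simp [paddedSymbol, hj.2 k hk]

lemma mul_pow_sub_pow_eq {N K : ℕ} (hN : 2 ≤ N) {m : ℕ} (hm : m ≤ K) :
    (N : ℝ) * ((N : ℝ) ^ K - (N : ℝ) ^ m) =
      (N : ℝ) ^ K * ((N : ℝ) - 1) * ∑ k ∈ Finset.range (K - m), 1 / (N : ℝ) ^ k := by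
  have hN2 : (2 : ℝ) ≤ N := by exact_mod_cast hN
  obtain ⟨c, rfl⟩ : ∃ c, K = m + c := ⟨K - m, by omega⟩
  rw [add_tsub_cancel_left]
  have key : ((N : ℝ) - 1) * ∑ k ∈ Finset.range c, 1 / (N : ℝ) ^ k = N * (1 - 1 / (N : ℝ) ^ c) := by
    clear hm
    induction c with
    | zero => simp
    | succ c ih =>
      rw [Finset.sum_range_succ, mul_add, ih]
      field_simp
      ring
  rw [mul_assoc, key, pow_add]
  field_simp

/-- For each of `N ^ K` runs, database `n` is asked for the sum of one symbol of each message.  In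
what order the `N ^ K` possible choices of symbols appear is random.  Only the symbol of the desired
message depends on `n`, and it runs through all symbols. -/
def permutedSums (N K : ℕ) [NeZero N] (hN : 2 ≤ N) : RetrievalCode N K where
  Query := Equiv.Perm (Fin K → Fin N)
  J := Fin K → Fin N
  C := (Fin K → Fin N) × {x : Fin N // x ≠ 0}
  known m := N ^ m
  law := shiftedPermLaw
  answer _ _ _ π v j := ∑ k, paddedSymbol (v k) j (π j k)
  nonempty_C := ⟨0, ⟨⟨1, hN⟩, fun h => by simpa using congrArg Fin.val h⟩⟩
  law_map_eq n θ θ' := by rw [shiftedPermLaw_map, shiftedPermLaw_map]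
  decode _ _ _ _ hQ _ _ h := eq_of_forall_sum_paddedSymbol_eq hQ fun n j => congrFun (h n) j
  exists_known F _ _ π S := exists_known_sums F π S
  known_le m hm := by
    simpa using Nat.pow_le_pow_right (NeZero.pos N) hm
  cost m hm := by
    have hC : Fintype.card {x : Fin N // x ≠ 0} = N - 1 := by
      simp [Fintype.card_subtype_compl]
    rw [Fintype.card_prod, hC, Fintype.card_pi_const, Fintype.card_fin]
    push_cast [Nat.cast_sub (by omega : 1 ≤ N)]
    exact mul_pow_sub_pow_eq hN hm

end PermutedSums

/-- A single database needs its own code: for `N = 1` there are no nonzero symbol numbers and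
`permutedSums` would have empty messages. -/
lemma nonempty_retrievalCode {N : ℕ} (hN : 1 ≤ N) (K : ℕ) : Nonempty (RetrievalCode N K) := by
  rcases hN.eq_or_lt with rfl | hN'
  · exact ⟨downloadEverything K⟩
  · have : NeZero N := ⟨by omega⟩
    exact ⟨permutedSums N K hN'⟩

end Codes

end PIRPSI

namespace PIRPSI

/-! ### Achievability: block scheme, its rate, and the limit -/

noncomputable section Achievability

open scoped Classical

variable {𝒳 : Type*} {N K M : ℕ}

/-- The messages are independent of the queries and `A_n` is a function of `Q_n` and the messages,
so the law of `Q_n` fixes all that database `n` sees. -/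
lemma Scheme.isPrivate_of_map_eq [Fintype 𝒳] [Nonempty 𝒳] {L : ℕ} {𝒮 : Scheme 𝒳 N K M L}
    (h : ∀ n θ θ' ℍ ℍ', (𝒮.queryLaw θ ℍ).map (fun Q => Q n) =
      (𝒮.queryLaw θ' ℍ').map fun Q => Q n) : 𝒮.IsPrivate := by
  have key : ∀ n θ ℍ, (𝒮.jointLaw θ ℍ).map (fun ω => (ω.1 n, 𝒮.ans n ω, ω.2)) =
      ((𝒮.queryLaw θ ℍ).map fun Q => Q n).bind fun q =>
        (PMF.uniformOfFintype (Messages 𝒳 K L)).map fun w => (q, 𝒮.answer n q w, w) := by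
    intro n θ ℍ
    rw [Scheme.jointLaw, PMF.map_bind, PMF.bind_map]
    simp only [PMF.map_comp]
    rfl
  intro n θ θ' ℍ ℍ'
  rw [key, key, h n θ θ' ℍ ℍ']

/-- Block number `t` of a message. -/
def block {B D : ℕ} (t : Fin B) (u : Fin (B * D) → 𝒳) : Fin D → 𝒳 :=
  fun x => u (finProdFinEquiv (t, x))

lemma eq_of_forall_block_eq {B D : ℕ} {u u' : Fin (B * D) → 𝒳} (h : ∀ t, block t u = block t u') :
    u = u' := by
  funext l
  have := congrFun (h (finProdFinEquiv.symm l).1) (finProdFinEquiv.symm l).2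
  simpa only [block, Prod.mk.eta, Equiv.apply_symm_apply] using this

/-- The ranks `i` of which block `t` is cached. -/
def cachedRanks (r : Fin M → ℝ) (B D : ℕ) (t : Fin B) : Finset (Fin M) :=
  Finset.univ.filter fun i => ((t : ℕ) + 1) * D ≤ ⌊r i * (B * D : ℕ)⌋₊

lemma block_eq_of_cached_eq {r : Fin M → ℝ} {ℍ : CacheIndex M K} {B D : ℕ}
    {w w' : Messages 𝒳 K (B * D)} (h : cached r ℍ w = cached r ℍ w') {t : Fin B} {i : Fin M}
    (hi : i ∈ cachedRanks r B D t) : block t (w (ℍ i)) = block t (w' (ℍ i)) := by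
  funext x
  simp only [cachedRanks, Finset.mem_filter, Finset.mem_univ, true_and] at hi
  refine congrFun (congrFun h i) ⟨finProdFinEquiv (t, x), lt_of_lt_of_le ?_ hi⟩
  have := x.2
  rw [finProdFinEquiv_apply_val]
  simp only
  rw [add_mul, one_mul, mul_comm D]
  omega

/-- The messages are cut into `B` blocks of length `D`, each of which is embedded into `R.C → F`
by `φ`.  All blocks are retrieved by the same queries of `R`, but the answers for a block are
compressed to as many symbols as a user who has cached the block of some messages lacks. -/
def blockScheme (R : RetrievalCode N K) {F : Type} [Field F] (α : R.J → F) (r : Fin M → ℝ)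
    (B : ℕ) {D : ℕ} (φ : (Fin D → 𝒳) → R.C → F) : Scheme 𝒳 N K M (B * D) where
  Query := R.Query
  Answer := (t : Fin B) → Fin (Fintype.card R.J - R.known (cachedRanks r B D t).card) → F
  queryLaw θ _ := R.law θ
  answer n q w t := syndrome α _ (R.answer F n q fun k => φ (block t (w k)))

section

variable [Fintype 𝒳] (R : RetrievalCode N K) {F : Type} [Field F] {α : R.J → F}
  (r : Fin M → ℝ) {B D : ℕ} {φ : (Fin D → 𝒳) → R.C → F}

lemma blockScheme_isPrivate [Nonempty 𝒳] : (blockScheme R α r B φ).IsPrivate :=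
  Scheme.isPrivate_of_map_eq fun n θ θ' _ _ => R.law_map_eq n θ θ'

lemma blockScheme_equivocation [Nonempty 𝒳] (hα : Function.Injective α)
    (hφ : Function.Injective φ) (θ : Fin K) (ℍ : CacheIndex M K) :
    (blockScheme R α r B φ).equivocation r θ ℍ = 0 := by
  refine condEntropy_eq_zero _ _ _ ?_
  rintro ⟨Q, w⟩ hω ⟨Q', w'⟩ - h
  simp only [Prod.mk.injEq] at h
  obtain ⟨hc, rfl, hA⟩ := h
  have hQ : Q ∈ (R.law θ).support := by
    simp only [Scheme.jointLaw, PMF.mem_support_bind_iff, PMF.mem_support_map_iff] at hω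
    obtain ⟨Q₀, hQ₀, w₀, -, h₀⟩ := hω
    cases h₀
    exact hQ₀
  refine eq_of_forall_block_eq fun t => hφ ?_
  refine R.decode F θ Q hQ (fun k => φ (block t (w k))) (fun k => φ (block t (w' k))) fun n => ?_
  obtain ⟨Z, hZ, hknown⟩ := R.exists_known F n (Q n) ((cachedRanks r B D t).map ℍ)
  rw [Finset.card_map] at hZ
  -- The cached blocks fix the predictable symbols `Z`, and the syndrome supplies the rest of the
  -- uncompressed answer.
  refine eq_of_syndrome_eq hα (congrFun (congrFun hA n) t) hZ (hknown _ _ fun k hk => ?_)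
  obtain ⟨i, hi, rfl⟩ := Finset.mem_map.1 hk
  rw [block_eq_of_cached_eq hc hi]

lemma blockScheme_download_le [Nontrivial 𝒳] [Fintype F] (hM : M ≤ K) (θ : Fin K)
    (ℍ : CacheIndex M K) :
    (blockScheme R α r B φ).download θ ℍ ≤ ENNReal.ofReal
      (Fintype.card R.C * Real.logb (Fintype.card 𝒳) (Fintype.card F) *
        ∑ t : Fin B, ∑ k ∈ Finset.range (K - (cachedRanks r B D t).card), 1 / (N : ℝ) ^ k) := by
  have hb : 2 ≤ Fintype.card 𝒳 := Fintype.one_lt_card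
  set x := Real.logb (Fintype.card 𝒳) (Fintype.card F) with hx
  have hm : ∀ t, (cachedRanks r B D t).card ≤ K := fun t =>
    (Finset.card_le_univ _).trans (by simpa using hM)
  have hcard : Real.logb (Fintype.card 𝒳) (Fintype.card ((t : Fin B) →
      Fin (Fintype.card R.J - R.known (cachedRanks r B D t).card) → F)) =
      ∑ t : Fin B, (Fintype.card R.J - R.known (cachedRanks r B D t).card : ℝ) * x := by
    rw [Fintype.card_pi, Nat.cast_prod, Real.logb_prod]
    · refine Finset.sum_congr rfl fun t _ => ?_
      rw [Fintype.card_pi_const, Nat.cast_pow, Real.logb_pow, Nat.cast_sub (R.known_le _ (hm t))]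
    · intro t _
      exact_mod_cast Fintype.card_ne_zero
  have hterm : ∀ n, entropy (Fintype.card 𝒳) ((blockScheme R α r B φ).jointLaw θ ℍ)
      ((blockScheme R α r B φ).ans n) ≤ ENNReal.ofReal
      (∑ t : Fin B, (Fintype.card R.J - R.known (cachedRanks r B D t).card : ℝ) * x) := by
    intro n
    rw [← hcard]
    exact entropy_le_logb_card hb (α := (t : Fin B) →
      Fin (Fintype.card R.J - R.known (cachedRanks r B D t).card) → F) _ _
  refine (Finset.sum_le_sum fun n _ => hterm n).trans (le_of_eq ?_)
  rw [Finset.sum_const, Finset.card_univ, Fintype.card_fin, nsmul_eq_mul,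
    ← ENNReal.ofReal_natCast, ← ENNReal.ofReal_mul (by positivity), Finset.mul_sum,
    Finset.mul_sum]
  congr 1
  refine Finset.sum_congr rfl fun t _ => ?_
  rw [← mul_assoc, R.cost _ (hm t)]
  ring

end

/-- The blocks with `t < ⌊r i * B⌋₊` are entirely cached; the floor costs at most one further block.
-/
lemma card_filter_notMem_cachedRanks_le {r : Fin M → ℝ} (hr0 : ∀ i, 0 ≤ r i)
    (hr1 : ∀ i, r i ≤ 1) (B D : ℕ) (i : Fin M) :
    ((Finset.univ.filter fun t : Fin B => i ∉ cachedRanks r B D t).card : ℝ) ≤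
      (1 - r i) * B + 1 := by
  have hf : ⌊r i * B⌋₊ ≤ B := by
    refine Nat.floor_le_of_le ?_
    have := hr1 i
    exact mul_le_of_le_one_left (by positivity) this
  have hsub : (Finset.univ.filter fun t : Fin B => i ∉ cachedRanks r B D t) ⊆
      (Finset.univ.filter fun t : Fin B => (t : ℕ) < ⌊r i * B⌋₊)ᶜ := by
    intro t
    simp only [Finset.mem_filter, Finset.mem_univ, true_and, Finset.mem_compl, cachedRanks]
    refine mt fun ht => Nat.le_floor ?_
    have h1 : (((t : ℕ) + 1 : ℕ) : ℝ) ≤ r i * B :=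
      (Nat.le_floor_iff (mul_nonneg (hr0 i) (by positivity))).1 ht
    push_cast at h1 ⊢
    rw [← mul_assoc]
    gcongr
  have h := Finset.card_le_card hsub
  rw [Finset.card_compl, Fintype.card_fin, Fin.card_filter_val_lt, min_eq_right hf] at h
  have h' : ((Finset.univ.filter fun t : Fin B => i ∉ cachedRanks r B D t).card : ℝ) ≤
      (B : ℝ) - ⌊r i * B⌋₊ := by
    rw [← Nat.cast_sub hf]
    exact_mod_cast h
  have := Nat.lt_floor_add_one (r i * B)
  linarith

/-- As `r` is decreasing, a block cached for rank `i` is cached for all `i + 1` ranks up to `i`. -/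
lemma notMem_cachedRanks_of_card_le {r : Fin M → ℝ} (hr : Antitone r) {B D : ℕ} {t : Fin B}
    {i : Fin M} (h : (cachedRanks r B D t).card ≤ i) : i ∉ cachedRanks r B D t := by
  intro hi
  have hsub : Finset.Iic i ⊆ cachedRanks r B D t := by
    intro j hj
    simp only [cachedRanks, Finset.mem_filter, Finset.mem_univ, true_and] at hi ⊢
    refine hi.trans (Nat.floor_le_floor ?_)
    gcongr
    exact hr (Finset.mem_Iic.1 hj)
  have := Finset.card_le_card hsub
  rw [Fin.card_Iic] at this
  omega

lemma sum_cost_blocks_le {r : Fin M → ℝ} (hN : 1 ≤ N) (hM : M ≤ K) (hr0 : ∀ i, 0 ≤ r i)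
    (hr1 : ∀ i, r i ≤ 1) (hr : Antitone r) (B D : ℕ) :
    ∑ t : Fin B, ∑ k ∈ Finset.range (K - (cachedRanks r B D t).card), 1 / (N : ℝ) ^ k ≤
      B * costFormula N K M r + M := by
  have hN1 : (1 : ℝ) ≤ N := by exact_mod_cast hN
  set g : ℕ → ℝ := fun k => 1 / (N : ℝ) ^ k with hg
  have hg0 : ∀ k, 0 ≤ g k := fun k => by positivity
  have hg1 : ∀ k, g k ≤ 1 := fun k => by
    rw [hg]
    exact div_le_one_of_le₀ (one_le_pow₀ hN1) (by positivity)
  calc _ ≤ ∑ t : Fin B, (∑ k ∈ Finset.range (K - M), g k +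
        ∑ i : Fin M, if i ∉ cachedRanks r B D t then g (K - 1 - i) else 0) := by
        refine Finset.sum_le_sum fun t _ => ?_
        rw [sum_range_sub_eq_add hM ((Finset.card_le_univ _).trans (by simp)) g]
        gcongr with i
        by_cases hi : (cachedRanks r B D t).card ≤ i
        · rw [if_pos hi, if_pos (notMem_cachedRanks_of_card_le hr hi)]
        · rw [if_neg hi]
          split_ifs <;> first | exact le_rfl | exact hg0 _
    _ = B * ∑ k ∈ Finset.range (K - M), g k + ∑ i : Fin M,
        ((Finset.univ.filter fun t : Fin B => i ∉ cachedRanks r B D t).card : ℝ) *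
          g (K - 1 - i) := by
        rw [Finset.sum_add_distrib, Finset.sum_const, Finset.card_univ, Fintype.card_fin,
          nsmul_eq_mul, Finset.sum_comm]
        congr 1
        refine Finset.sum_congr rfl fun i _ => ?_
        rw [← Finset.sum_filter, Finset.sum_const, nsmul_eq_mul]
    _ ≤ B * ∑ k ∈ Finset.range (K - M), g k +
        ∑ i : Fin M, (B * ((1 - r i) * g (K - 1 - i)) + 1) := by
        gcongr with i
        refine (mul_le_mul_of_nonneg_right (card_filter_notMem_cachedRanks_le hr0 hr1 B D i)
          (hg0 _)).trans ?_
        have := hg1 (K - 1 - i)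
        linarith
    _ = _ := by
        rw [Finset.sum_add_distrib, ← Finset.mul_sum, costFormula]
        simp only [hg, Finset.sum_const, Finset.card_univ, Fintype.card_fin, nsmul_eq_mul,
          mul_one, mul_one_div]
        ring

lemma exists_scheme [Fintype 𝒳] [Nontrivial 𝒳] (R : RetrievalCode N K) {r : Fin M → ℝ}
    (hN : 1 ≤ N) (hM : M ≤ K) (hr0 : ∀ i, 0 ≤ r i) (hr1 : ∀ i, r i ≤ 1) (hr : Antitone r) {T : ℕ}
    (hT : Fintype.card R.J ≤ T) :
    ∃ 𝒮 : Scheme 𝒳 N K M (T * (Fintype.card R.C * T)), 𝒮.IsPrivate ∧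
      (∀ θ ℍ, 𝒮.equivocation r θ ℍ = 0) ∧
      ∀ θ ℍ, 𝒮.download θ ℍ ≤ ENNReal.ofReal
        (Fintype.card R.C * (T + 1) * (T * costFormula N K M r + M)) := by
  set q := Fintype.card 𝒳 with hq
  have hq2 : 2 ≤ q := Fintype.one_lt_card
  have hq1 : (1 : ℝ) < q := by exact_mod_cast hq2
  -- Bertrand's postulate. With `q ^ T < p ≤ 2 * q ^ T`, a field element holds `T` symbols and costs
  -- at most `T + 1`. A block of `card C * T` symbols thus fits into `C → ZMod p`, and `card J ≤ T`
  -- leaves room for distinct nodes.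
  obtain ⟨p, hp, hqp, hp2⟩ := Nat.exists_prime_lt_and_le_two_mul (q ^ T) (by positivity)
  have : Fact p.Prime := ⟨hp⟩
  have hcard : Fintype.card (ZMod p) = p := ZMod.card p
  obtain ⟨α⟩ : Nonempty (R.J ↪ ZMod p) := by
    refine Function.Embedding.nonempty_of_card_le ?_
    rw [hcard]
    exact hT.trans ((Nat.lt_pow_self hq2).trans hqp).le
  obtain ⟨φ⟩ : Nonempty ((Fin (Fintype.card R.C * T) → 𝒳) ↪ (R.C → ZMod p)) := by
    refine Function.Embedding.nonempty_of_card_le ?_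
    rw [Fintype.card_pi_const, Fintype.card_fun, hcard, mul_comm, pow_mul]
    exact Nat.pow_le_pow_left hqp.le _
  refine ⟨blockScheme R α r T φ, blockScheme_isPrivate R r,
    blockScheme_equivocation R r α.injective φ.injective, fun θ ℍ =>
    (blockScheme_download_le R r hM θ ℍ).trans (ENNReal.ofReal_le_ofReal ?_)⟩
  have hp0 : (0 : ℝ) < p := by exact_mod_cast hp.pos
  have hlog : Real.logb q (Fintype.card (ZMod p)) ≤ T + 1 := by
    rw [hcard, Real.logb_le_iff_le_rpow hq1 hp0]
    have : ((T : ℝ) + 1) = ((T + 1 : ℕ) : ℝ) := by push_cast; rfl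
    rw [this, Real.rpow_natCast]
    have h2 : p ≤ q ^ (T + 1) := by
      rw [pow_succ, mul_comm]
      exact hp2.trans (Nat.mul_le_mul_right _ hq2)
    exact_mod_cast h2
  have hB := sum_cost_blocks_le hN hM hr0 hr1 hr T (Fintype.card R.C * T)
  have hnn : 0 ≤ ∑ t : Fin T, ∑ k ∈ Finset.range
      (K - (cachedRanks r T (Fintype.card R.C * T) t).card), 1 / (N : ℝ) ^ k :=
    Finset.sum_nonneg fun t _ => Finset.sum_nonneg fun k _ => by positivity
  exact mul_le_mul (mul_le_mul_of_nonneg_left hlog (Nat.cast_nonneg _)) hB hnn (by positivity)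

lemma isAchievable_costFormula [Fintype 𝒳] [Nontrivial 𝒳] {r : Fin M → ℝ} (hN : 1 ≤ N)
    (hM : M ≤ K) (hr0 : ∀ i, 0 ≤ r i) (hr1 : ∀ i, r i ≤ 1) (hr : Antitone r) :
    IsAchievable 𝒳 N K M r (ENNReal.ofReal (costFormula N K M r)) := by
  obtain ⟨R⟩ := nonempty_retrievalCode hN K
  have := R.nonempty_C
  set d := costFormula N K M r with hd
  set c := Fintype.card R.C with hc
  have hc0 : 0 < c := Fintype.card_pos
  -- `T` serves both as the number of blocks and as the number of symbols per field element, so both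
  -- the floor loss `M / T` and the field loss `1 / T` vanish.
  set T : ℕ → ℕ := fun j => j + Fintype.card R.J + 1 with hT
  have hT0 : ∀ j, 0 < T j := fun j => by simp [hT]
  have hTtop : Filter.Tendsto T Filter.atTop Filter.atTop :=
    Filter.tendsto_atTop_mono (fun j => by simp only [hT, id]; omega) Filter.tendsto_id
  choose 𝒮 hpriv heq hdown using fun j => exists_scheme (𝒳 := 𝒳) R hN hM hr0 hr1 hr
    (T := T j) (by simp only [hT]; omega)
  refine ⟨fun j => T j * (c * T j), 𝒮, ?_, hpriv, ?_, ?_⟩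
  · refine Filter.tendsto_atTop_mono (fun j => ?_) hTtop
    exact Nat.le_mul_of_pos_right _ (Nat.mul_pos hc0 (hT0 j))
  · intro θ ℍ
    simp [heq]
  · intro θ ℍ
    have hlim : Filter.Tendsto (fun j => ENNReal.ofReal
        ((1 + 1 / (T j : ℝ)) * (d + M * (1 / (T j : ℝ))))) Filter.atTop (𝓝 (ENNReal.ofReal d)) := by
      have h0 : Filter.Tendsto (fun j => 1 / (T j : ℝ)) Filter.atTop (𝓝 0) :=
        tendsto_one_div_atTop_nhds_zero_nat.comp hTtop
      have := (h0.const_add 1).mul ((h0.const_mul (M : ℝ)).const_add d)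
      simp only [add_zero, mul_zero, one_mul] at this
      exact (ENNReal.continuous_ofReal.tendsto d).comp this
    refine tendsto_of_tendsto_of_tendsto_of_le_of_le tendsto_const_nhds hlim (fun j => ?_)
      (fun j => ?_)
    -- The lower half of the squeeze is the converse itself, with zero equivocation.
    · have h := Scheme.ofReal_costFormula_mul_le (hpriv j) hN r hr0 θ ℍ
      simp only [heq, Finset.sum_const_zero, add_zero] at h
      refine (ENNReal.le_div_iff_mul_le (Or.inl ?_) (Or.inl (ENNReal.natCast_ne_top _))).2 h
      exact_mod_cast (Nat.mul_pos (hT0 j) (Nat.mul_pos hc0 (hT0 j))).ne'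
    · refine ENNReal.div_le_of_le_mul ((hdown j θ ℍ).trans (le_of_eq ?_))
      have h0 : (T j : ℝ) ≠ 0 := by exact_mod_cast (hT0 j).ne'
      rw [← ENNReal.ofReal_natCast, ← ENNReal.ofReal_mul' (by positivity)]
      congr 1
      push_cast
      field_simp
      rw [hd, hc, mul_comm]

end Achievability

end PIRPSI

theorem theorem1 (𝒳 : Type*) [Fintype 𝒳] [Nontrivial 𝒳] (N K M : ℕ)
    (hN : 1 ≤ N) (hK : 1 ≤ K) (hM : M ≤ K)
    (r : Fin M → ℝ) (hr0 : ∀ i, 0 ≤ r i) (hr1 : ∀ i, r i ≤ 1) (hr : Antitone r) :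
    PIRPSI.optimalCost 𝒳 N K M r =
      ENNReal.ofReal
        ((∑ k ∈ Finset.range (K - M), 1 / (N : ℝ) ^ k) +
          ∑ i : Fin M, (1 - r i) / (N : ℝ) ^ (K - 1 - (i : ℕ))) :=
  le_antisymm (sInf_le (PIRPSI.isAchievable_costFormula hN hM hr0 hr1 hr))
    -- One desired message and one cache pattern suffice for the converse, since the download of a
    -- private scheme does not depend on them.
    (le_sInf fun _ hd => PIRPSI.ofReal_costFormula_le_of_isAchievable hN r hr0 ⟨0, hK⟩
      (Fin.castLEEmb hM) hd)
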